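/- **Setting.** Let $p=2$, $q\ge 2$, $n=p+q+1$. A $2^p\times 2^q$ row-column design $d$ with $n$ two-level factors $F_1,\dots,F_n$ (without replication) is a $2^p\times 2^q$ array whose cells contain pairwise distinct level combinations $d[i,j]\in \mathrm{GF}(2)^n$. The observations follow the model $Y_{ij}=\mu+\tau_i+\rho_j+\gamma_{d[i,j]}+\varepsilon_{ij}$ with uncorrelated errors of mean $0$ and variance $\sigma^2$ and $$\gamma_{(x_1,\dots,x_n)}=\sum_{l}\alpha_{l,x_l}+\sum_{l<m}\beta_{lm,\,x_l+x_m},\qquad \sum_u\alpha_{l,u}=0,\quad \sum_u\beta_{lm,u}=0 .$$ The main effect of $F_l$ (respectively the two-factor interaction $F_l\times F_m$) is *unconfounded* if its parameters $\alpha_{l,u}$ (respectively $\beta_{lm,u}$) are estimable and their best linear unbiased estimators are uncorrelated with the best linear unbiased estimators of all estimable functions of the remaining parameters. The design is *2fi-optimal* if all its main effects are unconfounded and the number $t_d$ of its unconfounded two-factor interactions is the maximum among all $2^p\times 2^q$ row-column designs without replication with $n$ two-level factors in which all main effects are unconfounded. Put $$\phi(2,p,q,n)=\binom n2-N\binom{\alpha}{2}-\alpha\beta,\qquad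 N=2^{\min(p,q)}-1,\quad \alpha=\lfloor n/N\rfloor,\quad \beta=n-N\alpha ;$$ the *2fi-efficiency* of $d$ is $t_d/\phi(2,p,q,n)$. A $(p+q)\times n$ matrix $\mathcal G=\binom{\mathcal G_c}{\mathcal G_r}$ over $\mathrm{GF}(2)$ of full row rank, where $\mathcal G_c$ has $p$ rows and $\mathcal G_r$ has $q$ rows, *yields* the $2^p\times 2^q$ design whose cells are the sums $x+y$, where $x$ (indexing the rows of the array) runs through the row space of $\mathcal G_c$ and $y$ (indexing the columns) through the row space of $\mathcal G_r$. Let $I_v$ be the identity matrix, $\mathbf 1_v$ the all-one column, $\boldsymbol e_i$ the $i$-th unit column, $$E=\begin{pmatrix}1&0\\0&1\\1&1\end{pmatrix},\qquad F=\begin{pmatrix}1&0&1\\1&1&0\end{pmatrix}.$$ **Theorem.** In each of the following cases $\mathcal G$ has full row rank and yields a 2fi-optimal $2^{n-1}$ fractional factorial row-column design (its level combinations, each occurring once, are exactly the vectors orthogonal to one nonzero treatment defining word), with the stated 2fi-efficiency. (a) $q=2$, efficiency $\tfrac12$: $$\mathcal G=\begin{pmatrix}1&1&0&1&1\\0&1&1&1&1\\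 \hline 1&1&1&0&1\\1&0&1&1&1\end{pmatrix}.$$ (b) $q=3$, efficiency $\tfrac{11}{12}$: $$\mathcal G=\begin{pmatrix}I_2&F&\mathbf 1_2\\ \hline E&I_3+EF&\boldsymbol e_3\end{pmatrix}.$$ (c) $q=4$, efficiency $1$: $$\mathcal G=\begin{pmatrix}I_2&F&\mathbf 1_2&\boldsymbol e_1\\ \hline E&I_3+EF&\boldsymbol e_1&\mathbf 0\\ \mathbf 0&\mathbf 0&1&1\end{pmatrix}.$$ (d) $q\ge5$, efficiency $1$: $$\mathcal G=\begin{pmatrix}I_2&F&\mathbf 1_2&X_*\\ \hline E&I_3+EF&\mathbf 1_3&\mathbf 0\\ \mathbf 0&\mathbf 0&\mathbf 1_{q-3}&I_{q-3}\end{pmatrix},$$ where $X_*$ is any $2\times(q-3)$ matrix without zero columns such that each point of $\mathrm{PG}(1,2)$ appears $\lfloor n/3\rfloor$ or $\lfloor n/3\rfloor+1$ times among the columns of $(I_2\;|\;F\;|\;\mathbf 1_2\;|\;X_*)$; such an $X_*$ exists for every $q\ge5$. -/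

import Mathlib

open Finset Matrix

/-- An array with `s ^ p` rows and `s ^ q` columns, whose rows are labelled by the vectors of
`GF(s)^p` and whose columns are labelled by the vectors of `GF(s)^q` (the labels only serve to
tell rows, respectively columns, apart).  Each cell holds a level combination of `n` factors. -/
abbrev RCArray (s p q n : ℕ) : Type :=
  (Fin p → ZMod s) → (Fin q → ZMod s) → Fin n → ZMod s

/-- No level combination occurs in two cells of the array. -/
def Unreplicated {s p q n : ℕ} (d : RCArray s p q n) : Prop :=
  Function.Injective fun c : (Fin p → ZMod s) × (Fin q → ZMod s) => d c.1 c.2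

/-- The parameters of the analysis of variance model: the overall mean, the row effects, the
column effects, the effects `α_{l,u}` of the factors and the effects `β^{(v)}_{lm,u}` of the
interaction components `F_l F_m^v`.  Only the indices `inter l m v u` with `l < m` and `v ≠ 0`
enter the model. -/
inductive RCParam (s p q n : ℕ) : Type
  | mean : RCParam s p q n
  | row (i : Fin p → ZMod s) : RCParam s p q n
  | col (j : Fin q → ZMod s) : RCParam s p q n
  | main (l : Fin n) (u : ZMod s) : RCParam s p q n
  | inter (l m : Fin n) (v u : ZMod s) : RCParam s p q n

section Model

variable {s p q n : ℕ} [NeZero s]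

/-- The side conditions on the parameters: the effects of the levels of a factor, or of an
interaction component, sum to zero. -/
def SideConditions (θ : RCParam s p q n → ℝ) : Prop :=
  (∀ l, ∑ u : ZMod s, θ (.main l u) = 0) ∧
    ∀ l m v, l < m → v ≠ 0 → ∑ u : ZMod s, θ (.inter l m v u) = 0

/-- The treatment effect of the level combination `x`. -/
def treatmentEffect (θ : RCParam s p q n → ℝ) (x : Fin n → ZMod s) : ℝ :=
  ∑ l, θ (.main l (x l)) +
    ∑ l, ∑ m ∈ Finset.univ.filter (fun m => l < m),
      ∑ v ∈ Finset.univ.filter (fun v : ZMod s => v ≠ 0), θ (.inter l m v (x l + v * x m))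

/-- The expectation of the observation in row `i` and column `j`. -/
def expectedObs (d : RCArray s p q n) (θ : RCParam s p q n → ℝ)
    (i : Fin p → ZMod s) (j : Fin q → ZMod s) : ℝ :=
  θ .mean + θ (.row i) + θ (.col j) + treatmentEffect θ (d i j)

/-- The sum `∑ a_ij b_ij`.  As the errors are uncorrelated with common variance `σ²`, the
covariance of the linear estimators `∑ a_ij Y_ij` and `∑ b_ij Y_ij` is `σ²` times this number. -/
def cellDot (a b : (Fin p → ZMod s) → (Fin q → ZMod s) → ℝ) : ℝ :=
  ∑ i, ∑ j, a i j * b i j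

/-- `∑ a_ij Y_ij` is an unbiased estimator of the parametric function `f`. -/
def UnbiasedFor (d : RCArray s p q n) (f : (RCParam s p q n → ℝ) → ℝ)
    (a : (Fin p → ZMod s) → (Fin q → ZMod s) → ℝ) : Prop :=
  ∀ θ, SideConditions θ → cellDot a (expectedObs d θ) = f θ

/-- `∑ a_ij Y_ij` is the best linear unbiased (least squares) estimator of the parametric
function `f`: it is unbiased and has the least variance among the linear unbiased estimators. -/
def IsBLUE (d : RCArray s p q n) (f : (RCParam s p q n → ℝ) → ℝ)
    (a : (Fin p → ZMod s) → (Fin q → ZMod s) → ℝ) : Prop :=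
  UnbiasedFor d f a ∧ ∀ b, UnbiasedFor d f b → cellDot a a ≤ cellDot b b

/-- The parametric function `f` does not involve the parameters in `S`. -/
def NotInvolving (S : Set (RCParam s p q n)) (f : (RCParam s p q n → ℝ) → ℝ) : Prop :=
  ∀ θ θ', SideConditions θ → SideConditions θ' → (∀ k, k ∉ S → θ k = θ' k) → f θ = f θ'

/-- The effect with parameter set `S` is unconfounded: its parameters can be estimated, and their
estimators are uncorrelated with the estimators of all (estimable) functions of the other
parameters of the model. -/
def Unconfounded (d : RCArray s p q n) (S : Set (RCParam s p q n)) : Prop :=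
  ∀ k ∈ S, (∃ a, IsBLUE d (fun θ => θ k) a) ∧
    ∀ a, IsBLUE d (fun θ => θ k) a →
      ∀ f b, NotInvolving S f → IsBLUE d f b → cellDot a b = 0

/-- The main effect of factor `l` is unconfounded. -/
def MainUnconfounded (d : RCArray s p q n) (l : Fin n) : Prop :=
  Unconfounded d (Set.range (RCParam.main l))

/-- The two-factor interaction of the factors `l < m` is unconfounded: all its components are. -/
def InterUnconfounded (d : RCArray s p q n) (l m : Fin n) : Prop :=
  ∀ v : ZMod s, v ≠ 0 → Unconfounded d (Set.range (RCParam.inter l m v))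

/-- The number of unconfounded two-factor interactions. -/
noncomputable def numUnconfounded (d : RCArray s p q n) : ℕ :=
  Set.ncard {e : Fin n × Fin n | e.1 < e.2 ∧ InterUnconfounded d e.1 e.2}

/-- The array (without replication) is 2fi-optimal: all main effects are unconfounded, and the
number of unconfounded two-factor interactions is the largest among all arrays without
replication, with the same parameters, in which all main effects are unconfounded. -/
def TwoFiOptimal (d : RCArray s p q n) : Prop :=
  Unreplicated d ∧ (∀ l, MainUnconfounded d l) ∧
    ∀ d' : RCArray s p q n, Unreplicated d' → (∀ l, MainUnconfounded d' l) →
      numUnconfounded d' ≤ numUnconfounded d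

end Model

/-- `(s ^ min p q - 1) / (s - 1)` (an exact division for `s ≥ 2`). -/
def numPoints (s p q : ℕ) : ℕ := (s ^ min p q - 1) / (s - 1)

/-- The upper bound `φ(s,p,q,n)` for the number of unconfounded two-factor interactions. -/
def phiBound (s p q n : ℕ) : ℚ :=
  (n.choose 2 : ℚ) - (numPoints s p q : ℚ) * ((n / numPoints s p q).choose 2 : ℚ)
    - ((n / numPoints s p q : ℕ) : ℚ) * ((n % numPoints s p q : ℕ) : ℚ)

/-- The 2fi-efficiency of a design (with all main effects unconfounded). -/
noncomputable def twoFiEfficiency {s p q n : ℕ} [NeZero s] (d : RCArray s p q n) : ℚ :=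
  (numUnconfounded d : ℚ) / phiBound s p q n

/-- The level combinations in the array form the fraction of the full factorial that is determined
by `k` linearly independent treatment defining words, each occurring once. -/
def IsFractionalFactorial {s p q n : ℕ} (k : ℕ) (d : RCArray s p q n) : Prop :=
  Unreplicated d ∧ ∃ W : Matrix (Fin k) (Fin n) (ZMod s),
    LinearIndependent (ZMod s) W.row ∧
      {x : Fin n → ZMod s | ∃ i j, d i j = x} = {x | W *ᵥ x = 0}

/-- The array constructed from an array generator matrix with upper part `G_c` (`p` rows) and
lower part `G_r` (`q` rows): the cells are the sums of a vector generated by the rows of `G_c` and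
a vector generated by the rows of `G_r`. -/
def designOf {s p q n : ℕ} (G : Matrix (Fin p ⊕ Fin q) (Fin n) (ZMod s)) : RCArray s p q n :=
  fun i j => i ᵥ* G.toRows₁ + j ᵥ* G.toRows₂

/-- `G` has full row rank, and it yields a 2fi-optimal `s ^ (n - k)` fractional factorial
row-column design. -/
def YieldsOptimalFraction {s p q n : ℕ} [NeZero s] (k : ℕ)
    (G : Matrix (Fin p ⊕ Fin q) (Fin n) (ZMod s)) : Prop :=
  LinearIndependent (ZMod s) G.row ∧ IsFractionalFactorial k (designOf G) ∧
    TwoFiOptimal (designOf G)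

/-! The explicit matrices. -/

def matE : Matrix (Fin 3) (Fin 2) (ZMod 2) :=
  !![1, 0;
     0, 1;
     1, 1]

def matF : Matrix (Fin 2) (Fin 3) (ZMod 2) :=
  !![1, 0, 1;
     1, 1, 0]

/-- The all-one column of length `v`. -/
def oneCol (v : ℕ) : Matrix (Fin v) (Fin 1) (ZMod 2) := fun _ _ => 1

/-- The column of length `v` with a single entry `1`, in the (0-based) place `i`. -/
def unitCol {v : ℕ} (i : Fin v) : Matrix (Fin v) (Fin 1) (ZMod 2) :=
  fun k _ => if k = i then 1 else 0

/-- Consecutive numbering of four consecutive blocks of columns. -/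
def colBlocks (q : ℕ) (hq : 3 ≤ q) :
    ((Fin 2 ⊕ Fin 3) ⊕ Fin 1) ⊕ Fin (q - 3) ≃ Fin (2 + q + 1) :=
  ((Equiv.sumCongr
    ((Equiv.sumCongr finSumFinEquiv (Equiv.refl (Fin 1))).trans finSumFinEquiv)
      (Equiv.refl (Fin (q - 3)))).trans finSumFinEquiv).trans (finCongr (by omega))

/-- Consecutive numbering of two consecutive blocks of rows. -/
def rowBlocks (q : ℕ) (hq : 3 ≤ q) : Fin 3 ⊕ Fin (q - 3) ≃ Fin q :=
  finSumFinEquiv.trans (finCongr (by omega))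

/-- The generator matrix for `q = 2`. -/
def genA : Matrix (Fin 2 ⊕ Fin 2) (Fin (2 + 2 + 1)) (ZMod 2) :=
  Matrix.fromRows
    !![1, 1, 0, 1, 1;
       0, 1, 1, 1, 1]
    !![1, 1, 1, 0, 1;
       1, 0, 1, 1, 1]

/-- The generator matrix for `q = 3`. -/
def genB : Matrix (Fin 2 ⊕ Fin 3) (Fin (2 + 3 + 1)) (ZMod 2) :=
  (Matrix.fromRows
    (Matrix.fromCols (Matrix.fromCols 1 matF) (oneCol 2))
    (Matrix.fromCols (Matrix.fromCols matE (1 + matE * matF)) (unitCol 2))).submatrix id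
      ((Equiv.sumCongr finSumFinEquiv (Equiv.refl (Fin 1))).trans finSumFinEquiv).symm

/-- The generator matrix for `q = 4`. -/
def genC : Matrix (Fin 2 ⊕ Fin 4) (Fin (2 + 4 + 1)) (ZMod 2) :=
  (Matrix.fromRows
    (Matrix.fromCols (Matrix.fromCols (Matrix.fromCols 1 matF) (oneCol 2)) (unitCol 0))
    (Matrix.fromRows
      (Matrix.fromCols
        (Matrix.fromCols (Matrix.fromCols matE (1 + matE * matF)) (unitCol 0)) 0)
      (Matrix.fromCols (Matrix.fromCols (0 : Matrix (Fin 1) (Fin 2 ⊕ Fin 3) (ZMod 2)) (oneCol 1))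
        (oneCol 1)))).submatrix
      (Equiv.sumCongr (Equiv.refl (Fin 2)) (rowBlocks 4 (by norm_num)).symm)
      (colBlocks 4 (by norm_num)).symm

/-- The generator matrix for `q ≥ 5`, with a free block `X` of size `2 × (q - 3)`. -/
def genD (q : ℕ) (hq : 5 ≤ q) (X : Matrix (Fin 2) (Fin (q - 3)) (ZMod 2)) :
    Matrix (Fin 2 ⊕ Fin q) (Fin (2 + q + 1)) (ZMod 2) :=
  (Matrix.fromRows
    (Matrix.fromCols (Matrix.fromCols (Matrix.fromCols 1 matF) (oneCol 2)) X)
    (Matrix.fromRows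
      (Matrix.fromCols (Matrix.fromCols (Matrix.fromCols matE (1 + matE * matF)) (oneCol 3)) 0)
      (Matrix.fromCols
        (Matrix.fromCols (0 : Matrix (Fin (q - 3)) (Fin 2 ⊕ Fin 3) (ZMod 2)) (oneCol (q - 3)))
        1))).submatrix
      (Equiv.sumCongr (Equiv.refl (Fin 2)) (rowBlocks q (by omega)).symm)
      (colBlocks q (by omega)).symm

/-- The number of columns of `A` that represent the point `P` of the projective geometry. -/
noncomputable def pointCount {v n : ℕ} (A : Matrix (Fin v) (Fin n) (ZMod 2))
    (P : Projectivization (ZMod 2) (Fin v → ZMod 2)) : ℕ :=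
  Set.ncard {j : Fin n | Submodule.span (ZMod 2) {A.col j} = P.submodule}

/-- The block `X` has no zero column, and each point of `PG(1,2)` appears `⌊n/3⌋` or `⌊n/3⌋ + 1`
times among the columns of the upper part `(I | F | 1 | X)` of the generator matrix, where
`n = 2 + q + 1`. -/
def BalancedBlock (q : ℕ) (hq : 5 ≤ q) (X : Matrix (Fin 2) (Fin (q - 3)) (ZMod 2)) : Prop :=
  (∀ j, X.col j ≠ 0) ∧ ∀ P : Projectivization (ZMod 2) (Fin 2 → ZMod 2),
    pointCount (genD q hq X).toRows₁ P = (2 + q + 1) / 3 ∨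
      pointCount (genD q hq X).toRows₁ P = (2 + q + 1) / 3 + 1

/-! For two-level factors every effect has one free parameter, and its contrast is a character of
GF(2)^n, indexed by a word of weight one or two. The effect is unconfounded exactly when this
contrast is orthogonal to all rows, all columns and all other effects (`Clear`); this turns the
statistical statement into combinatorics of signs.

Upper bound. A column has four cells and, when main effects are clear, each factor is balanced on
it. A balanced function on GF(2)^2 is affine, so in each column factor `l` has a nonzero slope in
GF(2)^2, one of three values. A clear interaction needs two different slopes. Hence the clear pairs
form a subgraph of a complete tripartite graph, and the Turán count gives `phiBound`.

For `q = 2` and `q = 3` this bound is not attained. Clear main effects give strength three. Together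
with many clear pairs this makes every total vanish except those of the empty and the full word;
since no cell value is repeated, counting the zero cells by characters makes the full word constant
(`exists_full_word_constant`). For six factors with twelve clear pairs, a sign argument on two cells
of one row then gives a contradiction. For five factors with five clear pairs, the slopes along
every row and column sum to zero, and a graph argument produces a word of weight two or three that
is constant on the array.

Construction. If all nonzero kernel words of the generator have weight at least five, words of
weight at most two are confounded only with rows or columns (`clear_designOf_iff`). Clear pairs are
then the pairs whose columns differ in both the upper and the lower block. The small cases are
finite checks; for `q ≥ 5` the lower columns are distinct and the balanced upper block attains the
Turán bound. -/

/-! ### Least squares and unconfounded effects with two levels -/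

section Bilinear

variable {s p q n : ℕ} [NeZero s]

lemma cellDot_comm (a b : (Fin p → ZMod s) → (Fin q → ZMod s) → ℝ) :
    cellDot a b = cellDot b a := by
  simp only [cellDot, mul_comm]

lemma cellDot_sub_right (a b c : (Fin p → ZMod s) → (Fin q → ZMod s) → ℝ) :
    cellDot a (b - c) = cellDot a b - cellDot a c := by
  simp only [cellDot, Pi.sub_apply, mul_sub, Finset.sum_sub_distrib]

lemma cellDot_smul_right (a b : (Fin p → ZMod s) → (Fin q → ZMod s) → ℝ) (c : ℝ) :
    cellDot a (c • b) = c * cellDot a b := by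
  simp only [cellDot, Pi.smul_apply, smul_eq_mul, Finset.mul_sum, mul_left_comm]

lemma cellDot_sub_left (a b c : (Fin p → ZMod s) → (Fin q → ZMod s) → ℝ) :
    cellDot (a - b) c = cellDot a c - cellDot b c := by
  rw [cellDot_comm, cellDot_sub_right, cellDot_comm c, cellDot_comm c]

lemma cellDot_smul_left (a b : (Fin p → ZMod s) → (Fin q → ZMod s) → ℝ) (c : ℝ) :
    cellDot (c • a) b = c * cellDot a b := by
  rw [cellDot_comm, cellDot_smul_right, cellDot_comm]

lemma cellDot_self_nonneg (a : (Fin p → ZMod s) → (Fin q → ZMod s) → ℝ) :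
    0 ≤ cellDot a a :=
  Finset.sum_nonneg fun _ _ => Finset.sum_nonneg fun _ _ => mul_self_nonneg _

lemma eq_zero_of_cellDot_self {a : (Fin p → ZMod s) → (Fin q → ZMod s) → ℝ}
    (h : cellDot a a = 0) : a = 0 := by
  funext i j
  have h1 := (Finset.sum_eq_zero_iff_of_nonneg
    (fun i _ => Finset.sum_nonneg fun j _ => mul_self_nonneg (a i j))).1 h i (mem_univ i)
  have h2 := (Finset.sum_eq_zero_iff_of_nonneg
    (fun j _ => mul_self_nonneg (a i j))).1 h1 j (mem_univ j)
  exact mul_self_eq_zero.1 h2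

lemma treatmentEffect_sub_smul (θ θ' : RCParam s p q n → ℝ) (c : ℝ) (x : Fin n → ZMod s) :
    treatmentEffect (θ - c • θ') x = treatmentEffect θ x - c * treatmentEffect θ' x := by
  simp only [treatmentEffect, Pi.sub_apply, Pi.smul_apply, smul_eq_mul, Finset.sum_sub_distrib,
    Finset.mul_sum, mul_add]
  ring

lemma expectedObs_sub_smul (d : RCArray s p q n) (θ θ' : RCParam s p q n → ℝ) (c : ℝ) :
    expectedObs d (θ - c • θ') = expectedObs d θ - c • expectedObs d θ' := by
  funext i j
  simp only [expectedObs, treatmentEffect_sub_smul, Pi.sub_apply, Pi.smul_apply, smul_eq_mul]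
  ring

lemma SideConditions.sub_smul {θ θ' : RCParam s p q n → ℝ} (h : SideConditions θ)
    (h' : SideConditions θ') (c : ℝ) : SideConditions (θ - c • θ') := by
  refine ⟨fun l => ?_, fun l m v hlm hv => ?_⟩
  · simp only [Pi.sub_apply, Pi.smul_apply, smul_eq_mul, Finset.sum_sub_distrib,
      ← Finset.mul_sum, h.1, h'.1]
    ring
  · simp only [Pi.sub_apply, Pi.smul_apply, smul_eq_mul, Finset.sum_sub_distrib,
      ← Finset.mul_sum, h.2 l m v hlm hv, h'.2 l m v hlm hv]
    ring

/-- An unbiased estimator whose coefficients lie in the range of the model is the unique BLUE. -/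
lemma UnbiasedFor.cellDot_self_eq {d : RCArray s p q n} {f : (RCParam s p q n → ℝ) → ℝ}
    {θ : RCParam s p q n → ℝ} {c : ℝ} (hθ : SideConditions θ)
    (ha : UnbiasedFor d f (c • expectedObs d θ))
    {b : (Fin p → ZMod s) → (Fin q → ZMod s) → ℝ} (hb : UnbiasedFor d f b) :
    cellDot b b = cellDot (c • expectedObs d θ) (c • expectedObs d θ) +
      cellDot (b - c • expectedObs d θ) (b - c • expectedObs d θ) := by
  -- Unbiasedness at `θ` makes the difference of the two estimators orthogonal to `expectedObs d θ`,
  -- so Pythagoras applies.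
  have h := (hb θ hθ).trans (ha θ hθ).symm
  simp only [cellDot_sub_left, cellDot_sub_right, cellDot_smul_left, cellDot_smul_right] at h ⊢
  rw [cellDot_comm (expectedObs d θ) b, h]
  ring

lemma UnbiasedFor.isBLUE {d : RCArray s p q n} {f : (RCParam s p q n → ℝ) → ℝ}
    {θ : RCParam s p q n → ℝ} {c : ℝ} (hθ : SideConditions θ)
    (ha : UnbiasedFor d f (c • expectedObs d θ)) : IsBLUE d f (c • expectedObs d θ) :=
  ⟨ha, fun b hb => by
    rw [ha.cellDot_self_eq hθ hb]; exact le_add_of_nonneg_right (cellDot_self_nonneg _)⟩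

lemma IsBLUE.eq_of_unbiasedFor {d : RCArray s p q n} {f : (RCParam s p q n → ℝ) → ℝ}
    {θ : RCParam s p q n → ℝ} {c : ℝ} (hθ : SideConditions θ)
    (ha : UnbiasedFor d f (c • expectedObs d θ))
    {b : (Fin p → ZMod s) → (Fin q → ZMod s) → ℝ} (hb : IsBLUE d f b) :
    b = c • expectedObs d θ := by
  have h1 := ha.cellDot_self_eq hθ hb.1
  have h2 := hb.2 _ ha
  have h3 := cellDot_self_nonneg (b - c • expectedObs d θ)
  exact sub_eq_zero.1 (eq_zero_of_cellDot_self (by linarith))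

/-- An effect with two levels is unconfounded if and only if its contrast vector is orthogonal to
the expectations that do not involve the effect. -/
theorem unconfounded_pair_iff (d : RCArray s p q n) {k₀ k₁ : RCParam s p q n}
    (hneg : ∀ θ : RCParam s p q n → ℝ, SideConditions θ → θ k₁ = -θ k₀)
    {η : RCParam s p q n → ℝ} (hη : SideConditions η) (hη₀ : η k₀ = 1)
    (hoff : ∀ k, k ≠ k₀ → k ≠ k₁ → η k = 0)
    (hpos : cellDot (expectedObs d η) (expectedObs d η) ≠ 0) :
    Unconfounded d {k₀, k₁} ↔
      ∀ θ, SideConditions θ → θ k₀ = 0 → cellDot (expectedObs d η) (expectedObs d θ) = 0 := by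
  set g := expectedObs d η with hg
  set N := cellDot g g with hN
  constructor
  · intro h θ hθ hθ₀
    obtain ⟨⟨a, ha⟩, h2⟩ := h k₀ (by simp)
    -- `c • g` is the projection of the expectation of `θ` onto `g`. The residual is again an
    -- expectation, so it is the BLUE of what it estimates, and orthogonality to `g` makes that
    -- function free of the effect. Its covariance with `a` is `-c`, which must therefore vanish.
    set c := cellDot g (expectedObs d θ) / N
    have hb : expectedObs d θ - c • g = (1 : ℝ) • expectedObs d (θ - c • η) := by
      rw [one_smul, expectedObs_sub_smul]
    have hbg : cellDot (expectedObs d θ - c • g) g = 0 := by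
      rw [cellDot_sub_left, cellDot_smul_left, cellDot_comm, div_mul_cancel₀ _ hpos, sub_self]
    have hblue : IsBLUE d (fun θ' => cellDot (expectedObs d θ - c • g) (expectedObs d θ'))
        (expectedObs d θ - c • g) := by
      rw [hb]
      exact UnbiasedFor.isBLUE (hθ.sub_smul hη c) fun _ _ => rfl
    have h3 := h2 a ha _ _ ?_ hblue
    · rw [cellDot_sub_right, cellDot_smul_right, ha.1 θ hθ, ha.1 η hη] at h3
      simp only [hθ₀, hη₀] at h3
      have : c = 0 := by linarith
      exact (div_eq_zero_iff.1 this).resolve_right hpos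
    · intro θ₁ θ₂ h₁ h₂ h12
      have key : θ₂ = θ₁ - (θ₁ k₀ - θ₂ k₀) • η := by
        funext k
        simp only [Pi.sub_apply, Pi.smul_apply, smul_eq_mul]
        by_cases hk0 : k = k₀
        · rw [hk0, hη₀]; ring
        by_cases hk1 : k = k₁
        · rw [hk1, hneg _ hη, hneg _ h₁, hneg _ h₂, hη₀]; ring
        · rw [hoff k hk0 hk1, h12 k (by simp [hk0, hk1])]; ring
      dsimp only
      rw [key, expectedObs_sub_smul, cellDot_sub_right, cellDot_smul_right, ← hg, hbg]
      ring
  · intro h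
    have hunb : UnbiasedFor d (fun θ => θ k₀) (N⁻¹ • g) := by
      intro θ hθ
      have h1 := h (θ - θ k₀ • η) (hθ.sub_smul hη _) (by simp [hη₀])
      rw [expectedObs_sub_smul, cellDot_sub_right, cellDot_smul_right, ← hg, ← hN] at h1
      rw [cellDot_smul_left, sub_eq_zero.1 h1]
      field_simp
    have hunb' : UnbiasedFor d (fun θ => θ k₁) ((-N⁻¹) • g) := by
      intro θ hθ
      have h1 := hunb θ hθ
      rw [cellDot_smul_left] at h1 ⊢
      simp only [hneg θ hθ, ← h1]
      ring
    have horth : ∀ f b, NotInvolving {k₀, k₁} f → IsBLUE d f b → cellDot g b = 0 := by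
      intro f b hf hb
      -- `η - η` is the zero vector. It differs from `η` only in the effect, so `f` takes the same
      -- value at both and `b` is orthogonal to `g`.
      have h0 : SideConditions (η - (1 : ℝ) • η) := hη.sub_smul hη 1
      have h1 := hf η (η - (1 : ℝ) • η) hη h0 (fun k hk => by
        simp only [Set.mem_insert_iff, Set.mem_singleton_iff, not_or] at hk
        simp [hoff k hk.1 hk.2])
      rw [← hb.1 _ hη, ← hb.1 _ h0, expectedObs_sub_smul, one_smul, sub_self] at h1
      rw [cellDot_comm, h1]
      simp [cellDot]
    rintro k (rfl | rfl)
    · refine ⟨⟨_, hunb.isBLUE hη⟩, fun a ha f b hf hb => ?_⟩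
      rw [ha.eq_of_unbiasedFor hη hunb, cellDot_smul_left, ← hg, horth f b hf hb, mul_zero]
    · refine ⟨⟨_, hunb'.isBLUE hη⟩, fun a ha f b hf hb => ?_⟩
      rw [ha.eq_of_unbiasedFor hη hunb', cellDot_smul_left, ← hg, horth f b hf hb, mul_zero]

end Bilinear

/-! ### Signs, contrasts and words -/

lemma zmod_two_cases : ∀ u : ZMod 2, u = 0 ∨ u = 1 := by decide

lemma sum_zmod_two (f : ZMod 2 → ℝ) : ∑ u, f u = f 0 + f 1 := Fin.sum_univ_two f

/-- The nontrivial real character of `GF(2)`. -/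
def sgn (u : ZMod 2) : ℝ := if u = 0 then 1 else -1

@[simp] lemma sgn_zero : sgn 0 = 1 := by simp [sgn]

@[simp] lemma sgn_one : sgn 1 = -1 := by simp [sgn]

lemma sgn_add (u v : ZMod 2) : sgn (u + v) = sgn u * sgn v := by
  rcases zmod_two_cases u with rfl | rfl <;> rcases zmod_two_cases v with rfl | rfl <;>
    simp [show (1 : ZMod 2) + 1 = 0 from rfl]

lemma sgn_mul_self (u : ZMod 2) : sgn u * sgn u = 1 := by
  rcases zmod_two_cases u with rfl | rfl <;> simp

lemma sgn_ne_zero (u : ZMod 2) : sgn u ≠ 0 := by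
  rcases zmod_two_cases u with rfl | rfl <;> simp

/-- The unit vector `e_l` of `GF(2)^n`. -/
abbrev unitVec {n : ℕ} (l : Fin n) : Fin n → ZMod 2 := Pi.single l 1

/-- The contrast of the effect with word `x`. -/
def signOf {p q n : ℕ} (d : RCArray 2 p q n) (x : Fin n → ZMod 2) :
    (Fin p → ZMod 2) → (Fin q → ZMod 2) → ℝ :=
  fun i j => sgn (x ⬝ᵥ d i j)

/-- The sum of the contrast with word `x` over all cells. -/
def totalSum {p q n : ℕ} (d : RCArray 2 p q n) (x : Fin n → ZMod 2) : ℝ :=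
  ∑ i, ∑ j, signOf d x i j

/-- The contrast with word `x` is orthogonal to the rows, to the columns and to the contrasts of
the other main effects and two-factor interactions. -/
def Clear {p q n : ℕ} (d : RCArray 2 p q n) (x : Fin n → ZMod 2) : Prop :=
  (∀ i, ∑ j, signOf d x i j = 0) ∧ (∀ j, ∑ i, signOf d x i j = 0) ∧
    (∀ l, unitVec l ≠ x → totalSum d (x + unitVec l) = 0) ∧
      ∀ l m, l < m → unitVec l + unitVec m ≠ x → totalSum d (x + (unitVec l + unitVec m)) = 0

section Words

variable {n : ℕ}

lemma unitVec_injective : Function.Injective (unitVec : Fin n → _) := fun a b h => by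
  by_contra hab
  have := congrFun h a
  simp [hab] at this

lemma unitVec_add_ne_unitVec {a b l : Fin n} (hab : a ≠ b) :
    unitVec a + unitVec b ≠ unitVec l := fun h => by
  have h1 := congrFun h a
  have h2 := congrFun h b
  by_cases h3 : a = l <;> by_cases h4 : b = l <;> simp_all

lemma unitVec_add_eq {a b l m : Fin n} (hab : a < b) (hlm : l < m)
    (h : unitVec a + unitVec b = unitVec l + unitVec m) : a = l ∧ b = m := by
  have key : ∀ k : Fin n, (k = a ∨ k = b) → k = l ∨ k = m := by
    intro k hk
    by_contra hc
    push Not at hc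
    have h1 := congrFun h k
    rcases hk with rfl | rfl
    · simp [hab.ne, hc] at h1
    · simp [hab.ne', hc] at h1
  have ha := key a (.inl rfl)
  have hb := key b (.inr rfl)
  omega

end Words

/-! ### Unconfounded effects are clear words -/

section Characterization

variable {p q n : ℕ} (d : RCArray 2 p q n)

lemma signOf_add (x y : Fin n → ZMod 2) (i : Fin p → ZMod 2) (j : Fin q → ZMod 2) :
    signOf d (x + y) i j = signOf d x i j * signOf d y i j := by
  simp [signOf, sgn_add, add_dotProduct]

lemma signOf_unitVec (l : Fin n) (i : Fin p → ZMod 2) (j : Fin q → ZMod 2) :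
    signOf d (unitVec l) i j = sgn (d i j l) := by
  simp [signOf]

lemma cellDot_signOf (x y : Fin n → ZMod 2) :
    cellDot (signOf d x) (signOf d y) = totalSum d (x + y) := by
  simp [cellDot, totalSum, signOf_add]

lemma cellDot_signOf_self (x : Fin n → ZMod 2) : cellDot (signOf d x) (signOf d x) ≠ 0 := by
  simp [cellDot, signOf, sgn_mul_self]

lemma SideConditions.main_eq {θ : RCParam 2 p q n → ℝ} (hθ : SideConditions θ) (l : Fin n)
    (u : ZMod 2) : θ (.main l u) = θ (.main l 0) * sgn u := by
  have h := hθ.1 l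
  rw [sum_zmod_two] at h
  rcases zmod_two_cases u with rfl | rfl
  · simp
  · simp only [sgn_one]; linarith

lemma SideConditions.inter_eq {θ : RCParam 2 p q n → ℝ} (hθ : SideConditions θ) {l m : Fin n}
    (hlm : l < m) (u : ZMod 2) : θ (.inter l m 1 u) = θ (.inter l m 1 0) * sgn u := by
  have h := hθ.2 l m 1 hlm (by decide)
  rw [sum_zmod_two] at h
  rcases zmod_two_cases u with rfl | rfl
  · simp
  · simp only [sgn_one]; linarith

lemma filter_ne_zero_zmod_two :
    (Finset.univ.filter fun v : ZMod 2 => v ≠ 0) = {1} := by decide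

lemma expectedObs_eq {θ : RCParam 2 p q n → ℝ} (hθ : SideConditions θ) (i : Fin p → ZMod 2)
    (j : Fin q → ZMod 2) :
    expectedObs d θ i j = θ .mean + θ (.row i) + θ (.col j) +
      (∑ l, θ (.main l 0) * signOf d (unitVec l) i j +
        ∑ l, ∑ m ∈ Finset.univ.filter (fun m => l < m),
          θ (.inter l m 1 0) * signOf d (unitVec l + unitVec m) i j) := by
  rw [expectedObs, treatmentEffect]
  congr 2
  · exact Finset.sum_congr rfl fun l _ => by rw [hθ.main_eq, signOf_unitVec]
  · refine Finset.sum_congr rfl fun l _ => Finset.sum_congr rfl fun m hm => ?_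
    rw [filter_ne_zero_zmod_two, Finset.sum_singleton, one_mul,
      hθ.inter_eq (Finset.mem_filter.1 hm).2, signOf_add, signOf_unitVec, signOf_unitVec, sgn_add]

lemma cellDot_add_right (a b c : (Fin p → ZMod 2) → (Fin q → ZMod 2) → ℝ) :
    cellDot a (b + c) = cellDot a b + cellDot a c := by
  simp only [cellDot, Pi.add_apply, mul_add, Finset.sum_add_distrib]

lemma cellDot_sum_right {ι : Type*} (t : Finset ι) (a : (Fin p → ZMod 2) → (Fin q → ZMod 2) → ℝ)
    (f : ι → (Fin p → ZMod 2) → (Fin q → ZMod 2) → ℝ) :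
    cellDot a (∑ k ∈ t, f k) = ∑ k ∈ t, cellDot a (f k) := by
  classical
  induction t using Finset.induction_on with
  | empty => simp [cellDot]
  | insert k t hk ih => rw [Finset.sum_insert hk, Finset.sum_insert hk, cellDot_add_right, ih]

lemma cellDot_expectedObs (x : Fin n → ZMod 2) {θ : RCParam 2 p q n → ℝ} (hθ : SideConditions θ) :
    cellDot (signOf d x) (expectedObs d θ) =
      θ .mean * totalSum d x + ∑ i, θ (.row i) * ∑ j, signOf d x i j +
        ∑ j, θ (.col j) * ∑ i, signOf d x i j +
      (∑ l, θ (.main l 0) * totalSum d (x + unitVec l) +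
        ∑ l, ∑ m ∈ Finset.univ.filter (fun m => l < m),
          θ (.inter l m 1 0) * totalSum d (x + (unitVec l + unitVec m))) := by
  have h : expectedObs d θ = (fun i j => θ .mean + θ (.row i) + θ (.col j)) +
      (∑ l, θ (.main l 0) • signOf d (unitVec l) +
        ∑ l, ∑ m ∈ Finset.univ.filter (fun m => l < m),
          θ (.inter l m 1 0) • signOf d (unitVec l + unitVec m)) := by
    funext i j
    simp [expectedObs_eq d hθ, Finset.sum_apply]
  rw [h]
  simp only [cellDot_add_right, cellDot_sum_right, cellDot_smul_right, cellDot_signOf]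
  congr 1
  simp only [cellDot, mul_add, Finset.sum_add_distrib]
  congr 1
  · congr 1
    · simp only [totalSum, Finset.mul_sum, mul_comm]
    · simp only [Finset.mul_sum, mul_comm]
  · rw [Finset.sum_comm]
    simp only [Finset.mul_sum, mul_comm]

/-- The parameter vector whose only nonzero entries are `±1`, at the effect of a factor. -/
def mainVec (l : Fin n) : RCParam 2 p q n → ℝ
  | .main l' u => if l' = l then sgn u else 0
  | _ => 0

/-- The parameter vector whose only nonzero entries are `±1`, at a two-factor interaction. -/
def interVec (l m : Fin n) : RCParam 2 p q n → ℝ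
  | .inter l' m' v u => if l' = l ∧ m' = m ∧ v = 1 then sgn u else 0
  | _ => 0

lemma sum_sgn : ∑ u : ZMod 2, sgn u = 0 := by simp [sum_zmod_two]

lemma sideConditions_mainVec (l : Fin n) : SideConditions (mainVec l : RCParam 2 p q n → ℝ) := by
  refine ⟨fun l' => ?_, fun _ _ _ _ _ => by simp [mainVec]⟩
  by_cases h : l' = l <;> simp [mainVec, h, sum_sgn]

lemma sideConditions_interVec (l m : Fin n) :
    SideConditions (interVec l m : RCParam 2 p q n → ℝ) := by
  refine ⟨fun l' => by simp [interVec], fun l' m' v _ _ => ?_⟩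
  by_cases h : l' = l ∧ m' = m ∧ v = 1 <;> simp [interVec, h, sum_sgn]

lemma expectedObs_mainVec (l : Fin n) : expectedObs d (mainVec l) = signOf d (unitVec l) := by
  funext i j
  rw [expectedObs_eq d (sideConditions_mainVec l)]
  simp [mainVec]

lemma expectedObs_interVec {l m : Fin n} (hlm : l < m) :
    expectedObs d (interVec l m) = signOf d (unitVec l + unitVec m) := by
  funext i j
  rw [expectedObs_eq d (sideConditions_interVec l m)]
  simp only [interVec, zero_mul, Finset.sum_const_zero, zero_add, and_true, ite_mul, sgn_zero,
    one_mul, add_zero]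
  rw [Finset.sum_eq_single l, Finset.sum_eq_single m] <;> simp +contextual [hlm]

/-- The product with an expectation is linear in the parameters, with row, column and total sums of
contrasts as coefficients. Parameter vectors supported on one row, one column or one effect isolate
each coefficient; the coefficient of the mean vanishes with the row sums. -/
lemma clear_iff_cellDot (x : Fin n → ZMod 2) :
    Clear d x ↔ ∀ θ : RCParam 2 p q n → ℝ, SideConditions θ →
      (∀ l, unitVec l = x → θ (.main l 0) = 0) →
      (∀ l m, l < m → unitVec l + unitVec m = x → θ (.inter l m 1 0) = 0) →
        cellDot (signOf d x) (expectedObs d θ) = 0 := by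
  constructor
  · rintro ⟨h1, h2, h3, h4⟩ θ hθ hm hi
    have h5 : totalSum d x = 0 := by simp [totalSum, h1]
    rw [cellDot_expectedObs d x hθ]
    simp only [h1, h2, h5, mul_zero, Finset.sum_const_zero, zero_add]
    rw [Finset.sum_eq_zero, Finset.sum_eq_zero, add_zero]
    · refine fun l _ => Finset.sum_eq_zero fun m hlm => ?_
      have hlm := (Finset.mem_filter.1 hlm).2
      by_cases h : unitVec l + unitVec m = x
      · rw [hi l m hlm h, zero_mul]
      · rw [h4 l m hlm h, mul_zero]
    · intro l _
      by_cases h : unitVec l = x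
      · rw [hm l h, zero_mul]
      · rw [h3 l h, mul_zero]
  · intro h
    refine ⟨fun i => ?_, fun j => ?_, fun l hl => ?_, fun l m hlm hx => ?_⟩
    · let θ : RCParam 2 p q n → ℝ := fun k => match k with
        | .row i' => if i' = i then 1 else 0
        | _ => 0
      have hθ : SideConditions θ := ⟨by simp [θ], by simp [θ]⟩
      have := h θ hθ (by simp [θ]) (by simp [θ])
      rw [cellDot_expectedObs d x hθ] at this
      simpa [θ] using this
    · let θ : RCParam 2 p q n → ℝ := fun k => match k with
        | .col j' => if j' = j then 1 else 0
        | _ => 0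
      have hθ : SideConditions θ := ⟨by simp [θ], by simp [θ]⟩
      have := h θ hθ (by simp [θ]) (by simp [θ])
      rw [cellDot_expectedObs d x hθ] at this
      simpa [θ] using this
    · rw [← cellDot_signOf, ← expectedObs_mainVec]
      refine h _ (sideConditions_mainVec l) (fun l' hl' => ?_) (fun _ _ _ _ => rfl)
      have : l' ≠ l := by rintro rfl; exact hl hl'
      simp [mainVec, this]
    · rw [← cellDot_signOf, ← expectedObs_interVec d hlm]
      refine h _ (sideConditions_interVec l m) (fun _ _ => rfl) (fun l' m' _ hx' => ?_)
      have : ¬(l' = l ∧ m' = m) := by rintro ⟨rfl, rfl⟩; exact hx hx'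
      simp [interVec, this]

/-- The side conditions make the two parameters opposite, so `unconfounded_pair_iff` applies. No
other word of weight one or two equals `unitVec l`, so only one parameter is excluded in
`clear_iff_cellDot`. -/
theorem mainUnconfounded_iff (l : Fin n) : MainUnconfounded d l ↔ Clear d (unitVec l) := by
  have hS : Set.range (RCParam.main l : ZMod 2 → RCParam 2 p q n) = {.main l 0, .main l 1} := by
    ext k
    constructor
    · rintro ⟨u, rfl⟩
      rcases zmod_two_cases u with rfl | rfl <;> simp
    · rintro (rfl | rfl) <;> simp
  rw [MainUnconfounded, hS, unconfounded_pair_iff d (k₀ := .main l 0) (k₁ := .main l 1)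
    (fun θ hθ => by rw [hθ.main_eq]; simp) (sideConditions_mainVec l) (by simp [mainVec]) ?_
    (by rw [expectedObs_mainVec]; exact cellDot_signOf_self d _), expectedObs_mainVec,
    clear_iff_cellDot]
  · refine forall₂_congr fun θ _ => ⟨fun h h1 _ => h (h1 l rfl), fun h h1 => h ?_ ?_⟩
    · intro l' hl'
      rw [unitVec_injective hl', h1]
    · intro a b hab hx
      exact (unitVec_add_ne_unitVec hab.ne hx).elim
  · rintro (_ | _ | _ | ⟨l', u⟩ | _) h0 h1 <;> try rfl
    have : l' ≠ l := by
      rintro rfl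
      rcases zmod_two_cases u with rfl | rfl <;> simp at h0 h1
    simp [mainVec, this]

theorem interUnconfounded_iff {l m : Fin n} (hlm : l < m) :
    InterUnconfounded d l m ↔ Clear d (unitVec l + unitVec m) := by
  have hS : Set.range (RCParam.inter l m 1 : ZMod 2 → RCParam 2 p q n) =
      {.inter l m 1 0, .inter l m 1 1} := by
    ext k
    constructor
    · rintro ⟨u, rfl⟩
      rcases zmod_two_cases u with rfl | rfl <;> simp
    · rintro (rfl | rfl) <;> simp
  have h1 : InterUnconfounded d l m ↔ Unconfounded d (Set.range (RCParam.inter l m 1)) := by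
    refine ⟨fun h => h 1 (by decide), fun h v hv => ?_⟩
    rwa [(zmod_two_cases v).resolve_left hv]
  rw [h1, hS, unconfounded_pair_iff d (k₀ := .inter l m 1 0) (k₁ := .inter l m 1 1)
    (fun θ hθ => by rw [hθ.inter_eq hlm]; simp) (sideConditions_interVec l m)
    (by simp [interVec]) ?_
    (by rw [expectedObs_interVec d hlm]; exact cellDot_signOf_self d _),
    expectedObs_interVec d hlm, clear_iff_cellDot]
  · refine forall₂_congr fun θ _ => ⟨fun h _ h1 => h (h1 l m hlm rfl), fun h h1 => h ?_ ?_⟩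
    · intro l' hl'
      exact (unitVec_add_ne_unitVec hlm.ne hl'.symm).elim
    · intro a b hab hx
      obtain ⟨rfl, rfl⟩ := unitVec_add_eq hab hlm hx
      exact h1
  · rintro (_ | _ | _ | _ | ⟨l', m', v, u⟩) h0 h1 <;> try rfl
    have : ¬(l' = l ∧ m' = m ∧ v = 1) := by
      rintro ⟨rfl, rfl, rfl⟩
      rcases zmod_two_cases u with rfl | rfl <;> simp at h0 h1
    simp [interVec, this]

theorem numUnconfounded_eq :
    numUnconfounded d =
      Set.ncard {e : Fin n × Fin n | e.1 < e.2 ∧ Clear d (unitVec e.1 + unitVec e.2)} := by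
  unfold numUnconfounded
  congr 1
  ext e
  exact and_congr_right fun h => interUnconfounded_iff d h

end Characterization

/-! ### Character sums and affine functions on GF(2)^2 -/

section Characters

lemma add_self_zmod_two : ∀ u : ZMod 2, u + u = 0 := by decide

lemma add_self_word {ι : Type*} (x : ι → ZMod 2) : x + x = 0 :=
  funext fun k => add_self_zmod_two (x k)

lemma word_add_eq_zero_iff {ι : Type*} {x y : ι → ZMod 2} : x + y = 0 ↔ x = y := by
  constructor
  · intro h
    calc x = x + y + y := by rw [add_assoc, add_self_word, add_zero]
      _ = y := by rw [h, zero_add]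
  · rintro rfl
    exact add_self_word x

lemma sum_sgn_dotProduct {ι : Type*} [Fintype ι] [DecidableEq ι] (x : ι → ZMod 2) :
    ∑ i : ι → ZMod 2, sgn (x ⬝ᵥ i) = if x = 0 then 2 ^ Fintype.card ι else 0 := by
  split_ifs with h
  · simp [h]
  · obtain ⟨k, hk⟩ := Function.ne_iff.1 h
    have hk1 : x k = 1 := (zmod_two_cases _).resolve_left hk
    -- Translation by a unit vector where `x` is 1 flips every sign, so the sum equals its own
    -- negative.
    have h1 := Equiv.sum_comp (Equiv.addRight (Pi.single k 1 : ι → ZMod 2)) fun i => sgn (x ⬝ᵥ i)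
    simp only [Equiv.coe_addRight, dotProduct_add, dotProduct_single, hk1, mul_one, sgn_add,
      sgn_one, mul_neg, Finset.sum_neg_distrib] at h1
    linarith

lemma sum_sgn_dotProduct_of_ne {ι : Type*} [Fintype ι] [DecidableEq ι] {x : ι → ZMod 2}
    (hx : x ≠ 0) : ∑ i : ι → ZMod 2, sgn (x ⬝ᵥ i) = 0 := by
  rw [sum_sgn_dotProduct, if_neg hx]

lemma sum_fin_two_arrow {M : Type*} [AddCommMonoid M] (f : (Fin 2 → ZMod 2) → M) :
    ∑ i, f i = f ![0, 0] + f ![0, 1] + (f ![1, 0] + f ![1, 1]) := by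
  rw [← (finTwoArrowEquiv (ZMod 2)).symm.sum_comp, Fintype.sum_prod_type]
  exact (Fin.sum_univ_two _).trans (congrArg₂ _ (Fin.sum_univ_two _) (Fin.sum_univ_two _))

lemma fin_two_arrow_cases : ∀ v : Fin 2 → ZMod 2,
    v = ![0, 0] ∨ v = ![0, 1] ∨ v = ![1, 0] ∨ v = ![1, 1] := by decide

/-- A balanced function on `GF(2)^2` is affine and not constant. -/
lemma exists_affine_of_balanced (f : (Fin 2 → ZMod 2) → ZMod 2) (hf : ∑ i, sgn (f i) = 0) :
    ∃ k : Fin 2 → ZMod 2, k ≠ 0 ∧ ∀ i, f i = f 0 + k ⬝ᵥ i := by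
  have h0 : (0 : Fin 2 → ZMod 2) = ![0, 0] := by decide
  rw [sum_fin_two_arrow] at hf
  -- Exactly two of the four values are 1, so they sum to zero in GF(2) and the fourth is determined
  -- affinely; `c + a` and `b + a` are the slopes in the two coordinates.
  have key : ∀ a b c e : ZMod 2, sgn a + sgn b + (sgn c + sgn e) = 0 →
      (c + a ≠ 0 ∨ b + a ≠ 0) ∧ e = a + (c + a + (b + a)) := by
    intro a b c e
    rcases zmod_two_cases a with rfl | rfl <;> rcases zmod_two_cases b with rfl | rfl <;>
    rcases zmod_two_cases c with rfl | rfl <;> rcases zmod_two_cases e with rfl | rfl <;>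
    simp only [sgn_zero, sgn_one] <;> first | (intro h; norm_num at h; done) | (intro _; decide)
  obtain ⟨h1, h2⟩ := key _ _ _ _ hf
  refine ⟨![f ![1, 0] + f ![0, 0], f ![0, 1] + f ![0, 0]], ?_, fun i => ?_⟩
  · intro h
    have ha := congrFun h 0
    have hb := congrFun h 1
    simp at ha hb
    simp [ha, hb] at h1
  · have key2 : ∀ a b : ZMod 2, b = a + (b + a) := by decide
    rcases fin_two_arrow_cases i with rfl | rfl | rfl | rfl
    · simp [h0]
    · simpa [h0] using key2 _ _
    · simpa [h0] using key2 _ _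
    · simpa [h0] using h2

lemma exists_slopes {ι : Type*} (f : (Fin 2 → ZMod 2) → ι → ZMod 2) (hf : ∀ l, ∑ i, sgn (f i l) = 0) :
    ∃ κ : Matrix ι (Fin 2) (ZMod 2), (∀ l, κ l ≠ 0) ∧ ∀ i, f i = f 0 + κ *ᵥ i := by
  choose κ h0 h using fun l => exists_affine_of_balanced (fun i => f i l) (hf l)
  exact ⟨κ, h0, fun i => funext fun l => h l i⟩

variable {n : ℕ}

lemma sgn_affine (κ : Matrix (Fin n) (Fin 2) (ZMod 2)) (x y : Fin n → ZMod 2)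
    (i : Fin 2 → ZMod 2) :
    sgn (x ⬝ᵥ (y + κ *ᵥ i)) = sgn (x ⬝ᵥ y) * sgn ((x ᵥ* κ) ⬝ᵥ i) := by
  rw [dotProduct_add, dotProduct_mulVec, sgn_add]

/-- With slope zero the word would be constant along the line, and its sum would be ±4. -/
lemma vecMul_ne_zero_of_sum {κ : Matrix (Fin n) (Fin 2) (ZMod 2)} {x y : Fin n → ZMod 2}
    (h : ∑ i, sgn (x ⬝ᵥ (y + κ *ᵥ i)) = 0) : x ᵥ* κ ≠ 0 := by
  intro h0
  simp only [sgn_affine, h0, zero_dotProduct, sgn_zero, mul_one] at h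
  simp [sgn_ne_zero] at h

lemma sum_eq_zero_of_vecMul {κ : Matrix (Fin n) (Fin 2) (ZMod 2)} {x : Fin n → ZMod 2}
    (y : Fin n → ZMod 2) (h : x ᵥ* κ ≠ 0) : ∑ i, sgn (x ⬝ᵥ (y + κ *ᵥ i)) = 0 := by
  simp only [sgn_affine, ← Finset.mul_sum, sum_sgn_dotProduct_of_ne h, mul_zero]

lemma unitVec_vecMul (κ : Matrix (Fin n) (Fin 2) (ZMod 2)) (l : Fin n) :
    unitVec l ᵥ* κ = κ l := by
  exact Matrix.single_one_vecMul l κ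

end Characters

/-! ### Pairs with different slopes: the Turán count -/

section Counting

/-- The pairs of indices with different values. -/
def diffPairs {n : ℕ} {α : Type*} [DecidableEq α] (κ : Fin n → α) : Finset (Fin n × Fin n) :=
  Finset.univ.filter fun e => e.1 < e.2 ∧ κ e.1 ≠ κ e.2

/-- The number of indices with a given value. -/
def valueCount {n : ℕ} {α : Type*} [DecidableEq α] (κ : Fin n → α) (v : α) : ℕ :=
  (Finset.univ.filter fun l => κ l = v).card

variable {n : ℕ}

lemma sum_eq_sum_values {M : Type*} [AddCommMonoid M] (κ : Fin n → Fin 2 → ZMod 2)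
    (hκ : ∀ l, κ l ≠ 0) (g : Fin n → M) :
    ∑ l, g l = ∑ l ∈ Finset.univ.filter (fun l => κ l = ![0, 1]), g l +
      ∑ l ∈ Finset.univ.filter (fun l => κ l = ![1, 0]), g l +
      ∑ l ∈ Finset.univ.filter (fun l => κ l = ![1, 1]), g l := by
  simp only [Finset.sum_filter, ← Finset.sum_add_distrib]
  refine Finset.sum_congr rfl fun l _ => ?_
  rcases fin_two_arrow_cases (κ l) with h | h | h | h
  · exact (hκ l (h.trans (by decide))).elim
  all_goals simp [h]

lemma sum_comp_eq_valueCount {M : Type*} [AddCommMonoid M] (κ : Fin n → Fin 2 → ZMod 2)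
    (hκ : ∀ l, κ l ≠ 0) (f : (Fin 2 → ZMod 2) → M) :
    ∑ l, f (κ l) = valueCount κ ![0, 1] • f ![0, 1] + valueCount κ ![1, 0] • f ![1, 0] +
      valueCount κ ![1, 1] • f ![1, 1] := by
  have key : ∀ v, ∑ l ∈ Finset.univ.filter (fun l => κ l = v), f (κ l) = valueCount κ v • f v :=
    fun v => Finset.sum_eq_card_nsmul fun l hl => by rw [(Finset.mem_filter.1 hl).2]
  rw [sum_eq_sum_values κ hκ, key, key, key]

lemma valueCount_add (κ : Fin n → Fin 2 → ZMod 2) (hκ : ∀ l, κ l ≠ 0) :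
    valueCount κ ![0, 1] + valueCount κ ![1, 0] + valueCount κ ![1, 1] = n := by
  have := sum_comp_eq_valueCount κ hκ fun _ => 1
  simpa using this.symm

lemma valueCount_zero (κ : Fin n → Fin 2 → ZMod 2) (hκ : ∀ l, κ l ≠ 0) : valueCount κ 0 = 0 :=
  Finset.card_eq_zero.2 (Finset.filter_eq_empty_iff.2 fun l _ => hκ l)

lemma two_lt_valueCount {κ : Fin n → Fin 2 → ZMod 2} {r s t : Fin n} (hrs : r ≠ s) (hrt : r ≠ t)
    (hst : s ≠ t) (h₁ : κ r = κ s) (h₂ : κ r = κ t) : 2 < valueCount κ (κ r) :=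
  Finset.two_lt_card.2 ⟨r, by simp, s, by simp [h₁], t, by simp [h₂], hrs, hrt, hst⟩

lemma two_mul_card_filter_lt {r : Fin n → Fin n → Prop} [DecidableRel r]
    (hsymm : ∀ l m, r l m → r m l) (hirr : ∀ l, ¬ r l l) :
    2 * (Finset.univ.filter fun e : Fin n × Fin n => e.1 < e.2 ∧ r e.1 e.2).card =
      (Finset.univ.filter fun e : Fin n × Fin n => r e.1 e.2).card := by
  have h1 : (Finset.univ.filter fun e : Fin n × Fin n => e.1 < e.2 ∧ r e.1 e.2).card =
      (Finset.univ.filter fun e : Fin n × Fin n => e.2 < e.1 ∧ r e.1 e.2).card := by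
    refine Finset.card_bij (fun e _ => e.swap) ?_ ?_ ?_
    · simp only [Finset.mem_filter, Finset.mem_univ, true_and]
      exact fun e he => ⟨he.1, hsymm _ _ he.2⟩
    · exact fun _ _ _ _ h => Prod.swap_injective h
    · simp only [Finset.mem_filter, Finset.mem_univ, true_and]
      exact fun e he => ⟨e.swap, ⟨he.1, hsymm _ _ he.2⟩, e.swap_swap⟩
  rw [two_mul]
  nth_rewrite 2 [h1]
  rw [← Finset.card_union_of_disjoint]
  · congr 1
    ext e
    simp only [Finset.mem_union, Finset.mem_filter, Finset.mem_univ, true_and]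
    constructor
    · rintro (h | h) <;> exact h.2
    · intro h
      rcases lt_trichotomy e.1 e.2 with h' | h' | h'
      · exact .inl ⟨h', h⟩
      · rw [h'] at h; exact (hirr _ h).elim
      · exact .inr ⟨h', h⟩
  · rw [Finset.disjoint_left]
    simp only [Finset.mem_filter, Finset.mem_univ, true_and]
    exact fun e h h' => lt_asymm h.1 h'.1

/-- Among all `n ^ 2` ordered pairs, those with equal values number the sum of the squared
multiplicities. -/
lemma two_mul_card_diffPairs (κ : Fin n → Fin 2 → ZMod 2) (hκ : ∀ l, κ l ≠ 0) :
    2 * (diffPairs κ).card + (valueCount κ ![0, 1] ^ 2 + valueCount κ ![1, 0] ^ 2 +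
      valueCount κ ![1, 1] ^ 2) = n ^ 2 := by
  have h1 : 2 * (diffPairs κ).card = _ := two_mul_card_filter_lt
    (r := fun l m => κ l ≠ κ m) (fun _ _ h => h.symm) (fun _ h => h rfl)
  have h2 : (Finset.univ.filter fun e : Fin n × Fin n => κ e.1 = κ e.2).card =
      valueCount κ ![0, 1] ^ 2 + valueCount κ ![1, 0] ^ 2 + valueCount κ ![1, 1] ^ 2 := by
    rw [Finset.card_filter, Fintype.sum_prod_type_right]
    have : ∀ m, (∑ l, if κ l = κ m then 1 else 0) = valueCount κ (κ m) := fun m => by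
      rw [valueCount, Finset.card_filter]
    simp only [this]
    rw [sum_comp_eq_valueCount κ hκ, sq, sq, sq, smul_eq_mul, smul_eq_mul, smul_eq_mul]
  rw [h1, ← h2, add_comm, Finset.card_filter_add_card_filter_not]
  simp [sq]

lemma phiBound_eq (q n : ℕ) (hq : 2 ≤ q) :
    phiBound 2 2 q n = (n : ℚ) * (n - 1) / 2 - 3 * ((n / 3 : ℕ) * ((n / 3 : ℕ) - 1) / 2) -
      (n / 3 : ℕ) * (n % 3 : ℕ) := by
  have : numPoints 2 2 q = 3 := by simp [numPoints, hq]
  simp only [phiBound, this, Nat.cast_choose_two]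
  norm_num

/-- The deviations `tᵢ` of the multiplicities from `n / 3` add up to `n % 3`, and the defect from
the bound is half the sum of `tᵢ (tᵢ - 1)`. For integers this is nonnegative, and it vanishes when
each `tᵢ` is 0 or 1, which is the balanced case. -/
lemma card_diffPairs_eq (κ : Fin n → Fin 2 → ZMod 2) (hκ : ∀ l, κ l ≠ 0) {q : ℕ} (hq : 2 ≤ q) :
    ∃ t₁ t₂ t₃ : ℤ, (valueCount κ ![0, 1] : ℤ) = (n / 3 : ℕ) + t₁ ∧
      (valueCount κ ![1, 0] : ℤ) = (n / 3 : ℕ) + t₂ ∧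
      (valueCount κ ![1, 1] : ℤ) = (n / 3 : ℕ) + t₃ ∧
      ((diffPairs κ).card : ℚ) + ((t₁ * (t₁ - 1) + t₂ * (t₂ - 1) + t₃ * (t₃ - 1) : ℤ) : ℚ) / 2 =
        phiBound 2 2 q n := by
  have h1 := two_mul_card_diffPairs κ hκ
  have h2 := valueCount_add κ hκ
  have h3 := Nat.div_add_mod n 3
  rw [phiBound_eq q n hq]
  set α := n / 3
  set β := n % 3
  refine ⟨_, _, _, (add_sub_cancel _ _).symm, (add_sub_cancel _ _).symm,
    (add_sub_cancel _ _).symm, ?_⟩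
  set a := valueCount κ ![0, 1]
  set b := valueCount κ ![1, 0]
  set c := valueCount κ ![1, 1]
  have h1' : (2 * (diffPairs κ).card + (a ^ 2 + b ^ 2 + c ^ 2) : ℚ) = n ^ 2 := by exact_mod_cast h1
  have h2' : (a + b + c : ℚ) = n := by exact_mod_cast h2
  have h3' : (3 * α + β : ℚ) = n := by exact_mod_cast h3
  push_cast
  have e1 : (β : ℚ) = n - 3 * α := by linarith
  have e2 : (c : ℚ) = n - a - b := by linarith
  have e3 : ((diffPairs κ).card : ℚ) = (n ^ 2 - (a ^ 2 + b ^ 2 + c ^ 2)) / 2 := by linarith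
  rw [e3, e1, e2]
  ring

lemma int_mul_pred_nonneg (t : ℤ) : 0 ≤ t * (t - 1) := by
  rcases le_or_gt t 0 with h | h <;> nlinarith

lemma card_diffPairs_le (κ : Fin n → Fin 2 → ZMod 2) (hκ : ∀ l, κ l ≠ 0) {q : ℕ} (hq : 2 ≤ q) :
    ((diffPairs κ).card : ℚ) ≤ phiBound 2 2 q n := by
  obtain ⟨t₁, t₂, t₃, -, -, -, h⟩ := card_diffPairs_eq κ hκ hq
  have h1 : (0 : ℚ) ≤ ((t₁ * (t₁ - 1) + t₂ * (t₂ - 1) + t₃ * (t₃ - 1) : ℤ) : ℚ) := by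
    exact_mod_cast add_nonneg (add_nonneg (int_mul_pred_nonneg _) (int_mul_pred_nonneg _))
      (int_mul_pred_nonneg _)
  linarith

lemma card_diffPairs_of_balanced (κ : Fin n → Fin 2 → ZMod 2) (hκ : ∀ l, κ l ≠ 0) {q : ℕ}
    (hq : 2 ≤ q) (hbal : ∀ v, v ≠ 0 → valueCount κ v = n / 3 ∨ valueCount κ v = n / 3 + 1) :
    ((diffPairs κ).card : ℚ) = phiBound 2 2 q n := by
  obtain ⟨t₁, t₂, t₃, h1, h2, h3, h⟩ := card_diffPairs_eq κ hκ hq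
  have key : ∀ v, v ≠ 0 → ∀ t : ℤ, (valueCount κ v : ℤ) = (n / 3 : ℕ) + t → t * (t - 1) = 0 := by
    intro v hv t ht
    rcases hbal v hv with h' | h' <;> rw [h'] at ht
    · rw [show t = 0 by linarith]; rfl
    · rw [show t = 1 by push_cast at ht; linarith]; rfl
  rw [key _ (by decide) _ h1, key _ (by decide) _ h2, key _ (by decide) _ h3] at h
  simpa using h

end Counting

/-! ### The general upper bound for clear interactions -/

section UpperBound

variable {p q n : ℕ}

open Classical in
/-- The pairs of factors whose interaction is clear. -/
noncomputable def clearPairs (d : RCArray 2 p q n) : Finset (Fin n × Fin n) :=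
  Finset.univ.filter fun e => e.1 < e.2 ∧ Clear d (unitVec e.1 + unitVec e.2)

lemma mem_clearPairs {d : RCArray 2 p q n} {e : Fin n × Fin n} :
    e ∈ clearPairs d ↔ e.1 < e.2 ∧ Clear d (unitVec e.1 + unitVec e.2) := by
  simp [clearPairs]

lemma numUnconfounded_eq_card (d : RCArray 2 p q n) :
    numUnconfounded d = (clearPairs d).card := by
  rw [numUnconfounded_eq, ← Set.ncard_coe_finset]
  congr 1
  ext e
  simp [mem_clearPairs]

/-- Clear main effects are balanced in every column of four cells, hence affine there; a clear word
is balanced in the column too, so its slope is nonzero. -/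
lemma exists_column_slopes {d : RCArray 2 2 q n} (hd : ∀ l, Clear d (unitVec l))
    (j : Fin q → ZMod 2) :
    ∃ κ : Matrix (Fin n) (Fin 2) (ZMod 2), (∀ l, κ l ≠ 0) ∧ (∀ i, d i j = d 0 j + κ *ᵥ i) ∧
      ∀ x, Clear d x → x ᵥ* κ ≠ 0 := by
  obtain ⟨κ, h0, h⟩ := exists_slopes (fun i => d i j) fun l => by
    simpa [signOf_unitVec] using (hd l).2.1 j
  refine ⟨κ, h0, h, fun x hx => vecMul_ne_zero_of_sum (y := d 0 j) ?_⟩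
  simpa only [← h, signOf] using hx.2.1 j

lemma exists_row_slopes {d : RCArray 2 p 2 n} (hd : ∀ l, Clear d (unitVec l))
    (i : Fin p → ZMod 2) :
    ∃ κ : Matrix (Fin n) (Fin 2) (ZMod 2), (∀ l, κ l ≠ 0) ∧ (∀ j, d i j = d i 0 + κ *ᵥ j) ∧
      ∀ x, Clear d x → x ᵥ* κ ≠ 0 := by
  obtain ⟨κ, h0, h⟩ := exists_slopes (fun j => d i j) fun l => by
    simpa [signOf_unitVec] using (hd l).1 i
  refine ⟨κ, h0, h, fun x hx => vecMul_ne_zero_of_sum (y := d i 0) ?_⟩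
  simpa only [← h, signOf] using hx.1 i

lemma unitVec_add_vecMul_ne_zero_iff {κ : Matrix (Fin n) (Fin 2) (ZMod 2)} {l m : Fin n} :
    (unitVec l + unitVec m) ᵥ* κ ≠ 0 ↔ κ l ≠ κ m := by
  rw [add_vecMul, unitVec_vecMul, unitVec_vecMul, Ne, word_add_eq_zero_iff]

lemma clearPairs_subset_diffPairs {d : RCArray 2 p q n} {κ : Matrix (Fin n) (Fin 2) (ZMod 2)}
    (h : ∀ x, Clear d x → x ᵥ* κ ≠ 0) : clearPairs d ⊆ diffPairs κ := by
  intro e he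
  rw [mem_clearPairs] at he
  exact Finset.mem_filter.2 ⟨mem_univ _, he.1, unitVec_add_vecMul_ne_zero_iff.1 (h _ he.2)⟩

theorem card_clearPairs_le_phiBound {d : RCArray 2 2 q n} (hq : 2 ≤ q)
    (hd : ∀ l, Clear d (unitVec l)) : ((clearPairs d).card : ℚ) ≤ phiBound 2 2 q n := by
  obtain ⟨κ, h0, -, h⟩ := exists_column_slopes hd 0
  exact le_trans (by exact_mod_cast Finset.card_le_card (clearPairs_subset_diffPairs h))
    (card_diffPairs_le κ h0 hq)

end UpperBound

/-! ### Strength three and the full defining word -/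

section SmallWords

variable {p q n : ℕ} {d : RCArray 2 p q n}

lemma Clear.totalSum_eq_zero {x : Fin n → ZMod 2} (h : Clear d x) : totalSum d x = 0 := by
  simp [totalSum, h.1]

lemma Clear.totalSum_add_pair {x : Fin n → ZMod 2} (h : Clear d x) {l m : Fin n} (hlm : l ≠ m)
    (hx : unitVec l + unitVec m ≠ x) : totalSum d (x + (unitVec l + unitVec m)) = 0 := by
  rcases lt_or_gt_of_ne hlm with h1 | h1
  · exact h.2.2.2 l m h1 hx
  · rw [add_comm (unitVec l)] at hx ⊢
    exact h.2.2.2 m l h1 hx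

lemma word_eq_sum_unitVec (x : Fin n → ZMod 2) :
    x = ∑ l ∈ Finset.univ.filter (fun l => x l ≠ 0), unitVec l := by
  ext k
  rw [Finset.sum_apply, Finset.sum_filter, Finset.sum_eq_single k]
  · rcases zmod_two_cases (x k) with h | h <;> simp [h]
  · intro l _ hl
    simp [hl.symm]
  · simp

lemma word_of_hammingNorm_eq_one {x : Fin n → ZMod 2} (h : hammingNorm x = 1) :
    ∃ a, x = unitVec a := by
  obtain ⟨a, ha⟩ := Finset.card_eq_one.1 h
  exact ⟨a, by rw [word_eq_sum_unitVec x, ha, Finset.sum_singleton]⟩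

lemma word_of_hammingNorm_eq_two {x : Fin n → ZMod 2} (h : hammingNorm x = 2) :
    ∃ a b, a ≠ b ∧ x = unitVec a + unitVec b := by
  obtain ⟨a, b, hab, ha⟩ := Finset.card_eq_two.1 h
  exact ⟨a, b, hab, by rw [word_eq_sum_unitVec x, ha, Finset.sum_pair hab]⟩

lemma word_of_hammingNorm_eq_three {x : Fin n → ZMod 2} (h : hammingNorm x = 3) :
    ∃ a b c, a ≠ b ∧ a ≠ c ∧ b ≠ c ∧ x = unitVec a + (unitVec b + unitVec c) := by
  obtain ⟨a, b, c, hab, hac, hbc, ha⟩ := Finset.card_eq_three.1 h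
  exact ⟨a, b, c, hab, hac, hbc, by
    rw [word_eq_sum_unitVec x, ha, Finset.sum_insert (by simp [hab, hac]), Finset.sum_pair hbc]⟩

lemma word_of_hammingNorm_eq_four {x : Fin n → ZMod 2} (h : hammingNorm x = 4) :
    ∃ a b c e, a ≠ b ∧ a ≠ c ∧ a ≠ e ∧ b ≠ c ∧ b ≠ e ∧ c ≠ e ∧
      x = unitVec a + (unitVec b + (unitVec c + unitVec e)) := by
  obtain ⟨a, t, hat, ht, h3⟩ := Finset.card_eq_succ.1 h
  obtain ⟨b, c, e, hbc, hbe, hce, rfl⟩ := Finset.card_eq_three.1 h3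
  simp only [Finset.mem_insert, Finset.mem_singleton, not_or] at hat
  exact ⟨a, b, c, e, hat.1, hat.2.1, hat.2.2, hbc, hbe, hce, by
    rw [word_eq_sum_unitVec x, ← ht, Finset.sum_insert (by simp [hat]),
      Finset.sum_insert (by simp [hbc, hbe]), Finset.sum_pair hce]⟩

lemma hammingNorm_add_hammingNorm_one_add (x : Fin n → ZMod 2) :
    hammingNorm x + hammingNorm (1 + x) = n := by
  have h : ∀ l, (1 + x) l ≠ 0 ↔ ¬ x l ≠ 0 := by
    intro l
    rcases zmod_two_cases (x l) with h | h <;> simp [h, add_self_zmod_two]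
  simp only [hammingNorm, h]
  rw [Finset.card_filter_add_card_filter_not, Finset.card_univ, Fintype.card_fin]

/-- The complement `1 + x` has weight zero, one, or at least two. Strength three handles low
weights, so this isolates the words near the full one. -/
lemma word_cases (x : Fin n → ZMod 2) :
    hammingNorm x + 2 ≤ n ∨ (∃ l, x = 1 + unitVec l) ∨ x = 1 := by
  have h := hammingNorm_add_hammingNorm_one_add x
  have hx : x = 1 + (1 + x) := by rw [← add_assoc, add_self_word, zero_add]
  by_cases h0 : hammingNorm (1 + x) = 0
  · rw [hammingNorm_eq_zero.1 h0, add_zero] at hx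
    exact .inr (.inr hx)
  by_cases h1 : hammingNorm (1 + x) = 1
  · obtain ⟨l, hl⟩ := word_of_hammingNorm_eq_one h1
    rw [hl] at hx
    exact .inr (.inl ⟨l, hx⟩)
  · exact .inl (by omega)

lemma totalSum_pair (hd : ∀ l, Clear d (unitVec l)) {a b : Fin n} (hab : a ≠ b) :
    totalSum d (unitVec a + unitVec b) = 0 :=
  (hd a).2.2.1 b fun h => hab (unitVec_injective h.symm)

lemma totalSum_triple (hd : ∀ l, Clear d (unitVec l)) {a b c : Fin n} (hbc : b ≠ c) :
    totalSum d (unitVec a + (unitVec b + unitVec c)) = 0 :=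
  (hd a).totalSum_add_pair hbc (unitVec_add_ne_unitVec hbc)

/-- If the main effects are clear, the array has strength three. -/
lemma totalSum_eq_zero_of_hammingNorm_le (hd : ∀ l, Clear d (unitVec l)) {x : Fin n → ZMod 2}
    (hx : x ≠ 0) (h : hammingNorm x ≤ 3) : totalSum d x = 0 := by
  have h0 : hammingNorm x ≠ 0 := fun h => hx (hammingNorm_eq_zero.1 h)
  obtain h | h | h : hammingNorm x = 1 ∨ hammingNorm x = 2 ∨ hammingNorm x = 3 := by omega
  · obtain ⟨a, rfl⟩ := word_of_hammingNorm_eq_one h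
    exact (hd a).totalSum_eq_zero
  · obtain ⟨a, b, hab, rfl⟩ := word_of_hammingNorm_eq_two h
    exact totalSum_pair hd hab
  · obtain ⟨a, b, c, -, -, hbc, rfl⟩ := word_of_hammingNorm_eq_three h
    exact totalSum_triple hd hbc

lemma totalSum_zero (d : RCArray 2 p q n) : totalSum d 0 = 2 ^ p * 2 ^ q := by
  simp [totalSum, signOf]

lemma totalSum_ne_zero_of_constant {x : Fin n → ZMod 2} {c : ZMod 2}
    (h : ∀ i j, x ⬝ᵥ d i j = c) : totalSum d x ≠ 0 := by
  simp [totalSum, signOf, h, sgn_ne_zero]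

/-- A sum of signs of extreme size has all its terms equal. -/
lemma constant_of_totalSum_eq {x : Fin n → ZMod 2} (c : ZMod 2)
    (h : totalSum d x = sgn c * (2 ^ p * 2 ^ q)) (i : Fin p → ZMod 2) (j : Fin q → ZMod 2) :
    x ⬝ᵥ d i j = c := by
  have h1 : ∑ i, ∑ j, (1 - sgn c * signOf d x i j) = 0 := by
    simp only [Finset.sum_sub_distrib, ← Finset.mul_sum]
    rw [← totalSum, h, ← mul_assoc, sgn_mul_self]
    simp
  have h0 : ∀ i j, 0 ≤ 1 - sgn c * signOf d x i j := by
    intro i j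
    rw [signOf, ← sgn_add, sgn]
    split_ifs <;> norm_num
  have h2 := (Finset.sum_eq_zero_iff_of_nonneg
    (fun i _ => Finset.sum_nonneg fun j _ => h0 i j)).1 h1 i (mem_univ i)
  have h3 := (Finset.sum_eq_zero_iff_of_nonneg (fun j _ => h0 i j)).1 h2 j (mem_univ j)
  rw [signOf, ← sgn_add, sgn] at h3
  split_ifs at h3 with h4
  · exact (show ∀ y c : ZMod 2, c + y = 0 → y = c by decide) _ _ h4
  · norm_num at h3

/-- An array without replication with `n = p + q + 1` factors whose contrasts all sum to zero,
apart from those of the empty and the full word, is a regular fraction with the full word as its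
defining word. -/
theorem exists_full_word_constant {d : RCArray 2 p q (p + q + 1)} (hu : Unreplicated d)
    (h : ∀ x, x ≠ 0 → x ≠ 1 → totalSum d x = 0) : ∃ c, ∀ i j, 1 ⬝ᵥ d i j = c := by
  have h01 : (0 : Fin (p + q + 1) → ZMod 2) ≠ 1 := zero_ne_one
  have h1 : ∑ x, totalSum d x = 2 ^ p * 2 ^ q + totalSum d 1 := by
    rw [← totalSum_zero d, ← Finset.sum_pair h01]
    refine (Finset.sum_subset (subset_univ _) fun x _ hx => ?_).symm
    simp only [Finset.mem_insert, Finset.mem_singleton, not_or] at hx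
    exact h x hx.1 hx.2
  -- Summing over words first, orthogonality of characters counts the cells with value zero. There
  -- is at most one, so the total of the full word is `2 ^ (p + q)` or its negative.
  have h2 : ∑ x, totalSum d x = 2 ^ (p + q + 1) *
      ((Finset.univ.filter fun c : (Fin p → ZMod 2) × (Fin q → ZMod 2) =>
        d c.1 c.2 = 0).card : ℝ) := by
    simp only [totalSum, signOf]
    rw [Finset.sum_comm, Finset.card_filter, Fintype.sum_prod_type, Nat.cast_sum, Finset.mul_sum]
    refine Finset.sum_congr rfl fun i _ => ?_
    rw [Finset.sum_comm, Nat.cast_sum, Finset.mul_sum]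
    refine Finset.sum_congr rfl fun j _ => ?_
    simp only [dotProduct_comm _ (d i j), sum_sgn_dotProduct, Fintype.card_fin]
    split_ifs <;> simp
  have h3 : (Finset.univ.filter fun c : (Fin p → ZMod 2) × (Fin q → ZMod 2) =>
        d c.1 c.2 = 0).card ≤ 1 := by
    refine Finset.card_le_one.2 fun a ha b hb => hu ?_
    exact (Finset.mem_filter.1 ha).2.trans (Finset.mem_filter.1 hb).2.symm
  rw [h1, pow_succ, pow_add] at h2
  rcases Nat.le_one_iff_eq_zero_or_eq_one.1 h3 with h4 | h4 <;> rw [h4] at h2 <;> push_cast at h2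
  · exact ⟨1, constant_of_totalSum_eq 1 (by rw [sgn_one]; linarith)⟩
  · exact ⟨0, constant_of_totalSum_eq 0 (by rw [sgn_zero]; linarith)⟩

lemma vecMul_eq_zero_of_constant {κ : Matrix (Fin n) (Fin 2) (ZMod 2)} {x y : Fin n → ZMod 2}
    {c : ZMod 2} (h : ∀ i, x ⬝ᵥ (y + κ *ᵥ i) = c) : x ᵥ* κ = 0 := by
  by_contra h0
  have := sum_eq_zero_of_vecMul y h0
  simp [h, sgn_ne_zero] at this

lemma dotProduct_eq_of_vecMul_eq_zero {κ : Matrix (Fin n) (Fin 2) (ZMod 2)}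
    {x y : Fin n → ZMod 2} (h : x ᵥ* κ = 0) (i : Fin 2 → ZMod 2) :
    x ⬝ᵥ (y + κ *ᵥ i) = x ⬝ᵥ y := by
  rw [dotProduct_add, dotProduct_mulVec, h, zero_dotProduct, add_zero]

lemma add_add_eq_zero_of_ne : ∀ u : Fin 2 → ZMod 2, u ≠ 0 → ∀ v, v ≠ 0 → u ≠ v →
    ∀ w, w ≠ 0 → u ≠ w → v ≠ w → u + (v + w) = 0 := by decide

end SmallWords

/-! ### Six factors: at most eleven clear interactions -/

section SixFactors

/-- Equality in the Turán count: three numbers with sum 6 and sum of squares 12 are all 2. -/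
lemma valueCount_eq_two {κ : Fin 6 → Fin 2 → ZMod 2} (h0 : ∀ l, κ l ≠ 0)
    (h : (diffPairs κ).card = 12) :
    valueCount κ ![0, 1] = 2 ∧ valueCount κ ![1, 0] = 2 ∧ valueCount κ ![1, 1] = 2 := by
  have h1 := two_mul_card_diffPairs κ h0
  have h2 := valueCount_add κ h0
  rw [h] at h1
  generalize valueCount κ ![0, 1] = a at *
  generalize valueCount κ ![1, 0] = b at *
  generalize valueCount κ ![1, 1] = c at *
  have ha : a ≤ 3 := by nlinarith
  have hb : b ≤ 3 := by nlinarith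
  have hc : c = 6 - a - b := by omega
  subst hc
  interval_cases a <;> interval_cases b <;> simp_all

lemma exists_pair_of_valueCount {n : ℕ} {κ : Fin n → Fin 2 → ZMod 2} {v : Fin 2 → ZMod 2}
    (h : valueCount κ v = 2) : ∃ a b, a ≠ b ∧ Finset.univ.filter (fun l => κ l = v) = {a, b} ∧
      κ a = v ∧ κ b = v := by
  obtain ⟨a, b, hab, hs⟩ := Finset.card_eq_two.1 h
  refine ⟨a, b, hab, hs, ?_, ?_⟩
  · have : a ∈ Finset.univ.filter (fun l => κ l = v) := by rw [hs]; simp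
    exact (Finset.mem_filter.1 this).2
  · have : b ∈ Finset.univ.filter (fun l => κ l = v) := by rw [hs]; simp
    exact (Finset.mem_filter.1 this).2

/-- The contrasts with words `x`, `y` and `x + y`, and the products of these with a contrast `w`,
being balanced in a row, the contrast `w` is balanced on the cells where `x` and `y` vanish. -/
lemma sum_filter_signOf {p q n : ℕ} (d : RCArray 2 p q n) (i : Fin p → ZMod 2)
    (x y w : Fin n → ZMod 2) :
    4 * ∑ j ∈ Finset.univ.filter (fun j => x ⬝ᵥ d i j = 0 ∧ y ⬝ᵥ d i j = 0), signOf d w i j =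
      ∑ j, signOf d w i j + ∑ j, signOf d (w + x) i j + ∑ j, signOf d (w + y) i j +
        ∑ j, signOf d (w + (x + y)) i j := by
  rw [Finset.sum_filter, Finset.mul_sum, ← Finset.sum_add_distrib, ← Finset.sum_add_distrib,
    ← Finset.sum_add_distrib]
  refine Finset.sum_congr rfl fun j _ => ?_
  simp only [signOf_add]
  generalize signOf d w i j = r
  simp only [signOf]
  rcases zmod_two_cases (x ⬝ᵥ d i j) with h | h <;>
    rcases zmod_two_cases (y ⬝ᵥ d i j) with h' | h' <;> (simp [h, h']; try ring)

lemma sum_unitVec (n : ℕ) : ∑ l : Fin n, unitVec l = 1 := by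
  ext k
  simp [Finset.sum_apply, Pi.single_apply]

theorem card_clearPairs_le_eleven {d : RCArray 2 2 3 6} (hu : Unreplicated d)
    (hd : ∀ l, Clear d (unitVec l)) : (clearPairs d).card ≤ 11 := by
  by_contra! hcard
  choose κ h0 haff hclear using exists_column_slopes hd
  have hphi : phiBound 2 2 3 6 = 12 := by rw [phiBound_eq 3 6 (by norm_num)]; norm_num
  have hle : ∀ j, (diffPairs (κ j)).card ≤ 12 := fun j => by
    have := card_diffPairs_le (κ j) (h0 j) (q := 3) (by norm_num)
    rw [hphi] at this
    exact_mod_cast this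
  -- Twelve clear pairs exhaust the bound in every column, so all columns split the factors into the
  -- same three pairs of equal slope.
  have heq : ∀ j, clearPairs d = diffPairs (κ j) := fun j =>
    Finset.eq_of_subset_of_card_le (clearPairs_subset_diffPairs (hclear j)) ((hle j).trans hcard)
  have hgood : ∀ {l m}, κ 0 l ≠ κ 0 m → Clear d (unitVec l + unitVec m) := by
    have aux : ∀ {l m}, l < m → κ 0 l ≠ κ 0 m → Clear d (unitVec l + unitVec m) := by
      intro l m hlm h
      have : (l, m) ∈ clearPairs d := by
        rw [heq 0]
        exact Finset.mem_filter.2 ⟨mem_univ _, hlm, h⟩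
      exact (mem_clearPairs.1 this).2
    intro l m h
    rcases lt_trichotomy l m with h' | rfl | h'
    · exact aux h' h
    · exact (h rfl).elim
    · rw [add_comm]
      exact aux h' h.symm
  have hbad : ∀ {l m}, κ 0 l = κ 0 m → ∀ j, κ j l = κ j m := by
    have aux : ∀ {l m}, l < m → κ 0 l = κ 0 m → ∀ j, κ j l = κ j m := by
      intro l m hlm h j
      by_contra hj
      have : (l, m) ∈ diffPairs (κ 0) := by
        rw [← heq 0, heq j]
        exact Finset.mem_filter.2 ⟨mem_univ _, hlm, hj⟩
      exact (Finset.mem_filter.1 this).2.2 h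
    intro l m h j
    rcases lt_trichotomy l m with h' | rfl | h'
    · exact aux h' h j
    · rfl
    · exact (aux h' h.symm j).symm
  have hcard0 : (diffPairs (κ 0)).card = 12 := by
    have := hle 0
    rw [← heq 0] at this ⊢
    omega
  obtain ⟨hA, hB, hC⟩ := valueCount_eq_two (h0 0) hcard0
  have htwo : ∀ v, valueCount (κ 0) v ≤ 2 := by
    intro v
    rcases fin_two_arrow_cases v with rfl | rfl | rfl | rfl
    · rw [show (![0, 0] : Fin 2 → ZMod 2) = 0 by decide, valueCount_zero _ (h0 0)]
      norm_num
    all_goals omega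
  obtain ⟨a, a', haa, hfa, ha, ha'⟩ := exists_pair_of_valueCount hA
  obtain ⟨b, b', hbb, hfb, hb, hb'⟩ := exists_pair_of_valueCount hB
  obtain ⟨c, c', hcc, hfc, hc, hc'⟩ := exists_pair_of_valueCount hC
  have hone : (1 : Fin 6 → ZMod 2) = unitVec a + unitVec a' + (unitVec b + unitVec b') +
      (unitVec c + unitVec c') := by
    rw [← sum_unitVec, sum_eq_sum_values (κ 0) (h0 0), hfa, hfb, hfc, Finset.sum_pair haa,
      Finset.sum_pair hbb, Finset.sum_pair hcc]
  have hpair : ∀ {l m}, κ 0 l = κ 0 m → ∀ j, (unitVec l + unitVec m) ᵥ* κ j = 0 := by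
    intro l m h j
    by_contra h'
    exact unitVec_add_vecMul_ne_zero_iff.1 h' (hbad h j)
  have hva := hpair (ha.trans ha'.symm)
  have hvb := hpair (hb.trans hb'.symm)
  have hvc := hpair (hc.trans hc'.symm)
  have hone0 : ∀ j, 1 ᵥ* κ j = 0 := by
    intro j
    rw [hone, add_vecMul, add_vecMul, hva, hvb, hvc]
    simp
  have hcol : ∀ x, (∀ j, x ᵥ* κ j ≠ 0) → totalSum d x = 0 := by
    intro x hx
    rw [totalSum, Finset.sum_comm]
    refine Finset.sum_eq_zero fun j _ => ?_
    exact (Finset.sum_congr rfl fun i _ => by rw [signOf, haff j i]).trans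
      (sum_eq_zero_of_vecMul _ (hx j))
  have hsmall : ∀ x, x ≠ 0 → x ≠ 1 → totalSum d x = 0 := by
    intro x hx hx1
    rcases word_cases x with h | ⟨l, rfl⟩ | h
    · by_cases h3 : hammingNorm x ≤ 3
      · exact totalSum_eq_zero_of_hammingNorm_le hd hx h3
      obtain ⟨r, s, t, u, hrs, hrt, hru, hst, hsu, htu, rfl⟩ :=
        word_of_hammingNorm_eq_four (show hammingNorm x = 4 by omega)
      -- A word of weight four splits into a clear pair and another pair: no slope occurs three
      -- times, so two of `r`, `s`, `t` have different slopes.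
      have hlt : ∀ {l m k k' : Fin 6}, l ≠ k → m ≠ k → k ≠ k' → κ 0 l ≠ κ 0 m →
          totalSum d (unitVec l + unitVec m + (unitVec k + unitVec k')) = 0 := by
        intro l m k k' h1 h2 h3 h4
        refine (hgood h4).totalSum_add_pair h3 fun h5 => ?_
        have := congrFun h5 k
        simp [h1.symm, h2.symm, h3] at this
      by_cases h1 : κ 0 r = κ 0 s
      · by_cases h2 : κ 0 r = κ 0 t
        · have := two_lt_valueCount (κ := κ 0) hrs hrt hst h1 h2
          have := htwo (κ 0 r)
          omega
        · have := hlt hrs hst.symm hsu h2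
          rw [← this]
          congr 1
          ring
      · have := hlt hrt hst htu h1
        rw [← this]
        congr 1
        ring
    · refine hcol _ fun j => ?_
      rw [add_vecMul, hone0, zero_add, unitVec_vecMul]
      exact h0 j l
    · exact (hx1 h).elim
  obtain ⟨e, he⟩ := exists_full_word_constant (p := 2) (q := 3) hu hsmall
  have hrow : ∀ {l m}, κ 0 l ≠ κ 0 m → ∑ j, signOf d (unitVec l + unitVec m) 0 j = 0 :=
    fun h => (hgood h).1 0
  have hrow1 : ∀ {l m}, κ 0 l ≠ κ 0 m → ∑ j, signOf d (1 + (unitVec l + unitVec m)) 0 j = 0 := by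
    intro l m h
    have h1 : ∀ j, signOf d 1 0 j = sgn e := fun j => congrArg sgn (he 0 j)
    simp only [signOf_add d 1, h1]
    rw [← Finset.mul_sum, hrow h, mul_zero]
  -- Such a word is constant in each column, so all rows contribute equally to its total.
  have hcolrow : ∀ x, (∀ j, x ᵥ* κ j = 0) → totalSum d x = 0 → ∑ j, signOf d x 0 j = 0 := by
    intro x hx h
    have h1 : ∀ i j, signOf d x i j = signOf d x 0 j := by
      intro i j
      simp only [signOf]
      rw [haff j i, dotProduct_eq_of_vecMul_eq_zero (hx j)]
    simp only [totalSum, h1, Finset.sum_const, Finset.card_univ, nsmul_eq_mul] at h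
    exact (mul_eq_zero.1 h).resolve_left (by simp)
  set x := unitVec a + unitVec a' with hx
  set y := unitVec b + unitVec b' with hy
  have h2 : (2 : Fin 6 → ZMod 2) = 0 := by decide
  have nab : ∀ {l m}, κ 0 l = ![0, 1] → κ 0 m = ![1, 0] → κ 0 l ≠ κ 0 m := by
    intro l m h h'; rw [h, h']; decide
  have nac : ∀ {l m}, κ 0 l = ![0, 1] → κ 0 m = ![1, 1] → κ 0 l ≠ κ 0 m := by
    intro l m h h'; rw [h, h']; decide
  have nbc : ∀ {l m}, κ 0 l = ![1, 0] → κ 0 m = ![1, 1] → κ 0 l ≠ κ 0 m := by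
    intro l m h h'; rw [h, h']; decide
  -- The words `x`, `y`, `x + y` are balanced on row 0, so `x` and `y` both vanish on a quarter of
  -- its eight cells.
  have hT : (Finset.univ.filter fun j => x ⬝ᵥ d 0 j = 0 ∧ y ⬝ᵥ d 0 j = 0).card = 2 := by
    have hxy : x + y ≠ 0 := by
      intro h
      have h1 : (1 : Fin 6 → ZMod 2) = unitVec c + unitVec c' := by rw [hone, h, zero_add]
      have h3 := congrFun h1 a
      have hac : a ≠ c := fun h => nac ha hc (by rw [h])
      have hac' : a ≠ c' := fun h => nac ha hc' (by rw [h])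
      simp [hac, hac'] at h3
    have hxy1 : x + y ≠ 1 := by
      intro h
      have h1 : unitVec c + unitVec c' = 0 := by
        rw [hone] at h
        exact left_eq_add.1 h
      exact hcc (unitVec_injective (word_add_eq_zero_iff.1 h1))
    have h1 := sum_filter_signOf d 0 x y 0
    rw [zero_add, zero_add, zero_add, hcolrow x hva (totalSum_pair hd haa),
      hcolrow y hvb (totalSum_pair hd hbb), hcolrow (x + y)
        (fun j => by rw [add_vecMul, hva, hvb, add_zero]) (hsmall _ hxy hxy1)] at h1
    simp only [signOf, zero_dotProduct, sgn_zero, Finset.sum_const, nsmul_eq_mul, mul_one,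
      Finset.card_univ, Fintype.card_fun, ZMod.card, Fintype.card_fin] at h1
    norm_num at h1
    have h3 : (((Finset.univ.filter fun j => x ⬝ᵥ d 0 j = 0 ∧ y ⬝ᵥ d 0 j = 0).card : ℕ) : ℝ)
      = (2 : ℕ) := by push_cast; linarith
    exact_mod_cast h3
  obtain ⟨j₁, j₂, hj, hjT⟩ := Finset.card_eq_two.1 hT
  have hab := sum_filter_signOf d 0 x y (unitVec a + unitVec b)
  have hac := sum_filter_signOf d 0 x y (unitVec a + unitVec c)
  have hbc := sum_filter_signOf d 0 x y (unitVec b + unitVec c)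
  rw [hjT, Finset.sum_pair hj, hrow (nab ha hb),
    show unitVec a + unitVec b + x = unitVec a' + unitVec b by
      rw [hx]; linear_combination unitVec a * h2, hrow (nab ha' hb),
    show unitVec a + unitVec b + y = unitVec a + unitVec b' by
      rw [hy]; linear_combination unitVec b * h2, hrow (nab ha hb'),
    show unitVec a + unitVec b + (x + y) = unitVec a' + unitVec b' by
      rw [hx, hy]; linear_combination (unitVec a + unitVec b) * h2, hrow (nab ha' hb')] at hab
  rw [hjT, Finset.sum_pair hj, hrow (nac ha hc),
    show unitVec a + unitVec c + x = unitVec a' + unitVec c by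
      rw [hx]; linear_combination unitVec a * h2, hrow (nac ha' hc),
    show unitVec a + unitVec c + y = 1 + (unitVec a' + unitVec c') by
      rw [hy, hone]; linear_combination -unitVec a' * h2 - unitVec c' * h2, hrow1 (nac ha' hc'),
    show unitVec a + unitVec c + (x + y) = 1 + (unitVec a + unitVec c') by
      rw [hx, hy, hone]; linear_combination -unitVec c' * h2, hrow1 (nac ha hc')] at hac
  rw [hjT, Finset.sum_pair hj, hrow (nbc hb hc),
    show unitVec b + unitVec c + y = unitVec b' + unitVec c by
      rw [hy]; linear_combination unitVec b * h2, hrow (nbc hb' hc),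
    show unitVec b + unitVec c + x = 1 + (unitVec b' + unitVec c') by
      rw [hx, hone]; linear_combination -unitVec b' * h2 - unitVec c' * h2, hrow1 (nbc hb' hc'),
    show unitVec b + unitVec c + (x + y) = 1 + (unitVec b + unitVec c') by
      rw [hx, hy, hone]; linear_combination -unitVec c' * h2, hrow1 (nbc hb hc')] at hbc
  have hprod : ∀ j, signOf d (unitVec a + unitVec b) 0 j * signOf d (unitVec a + unitVec c) 0 j *
      signOf d (unitVec b + unitVec c) 0 j = 1 := by
    intro j
    rw [← signOf_add, ← signOf_add, show unitVec a + unitVec b + (unitVec a + unitVec c) +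
      (unitVec b + unitVec c) = 0 by
        linear_combination (unitVec a + unitVec b + unitVec c) * h2]
    simp [signOf]
  -- The contrasts of `ab`, `ac`, `bc` each sum to zero over `j₁` and `j₂`, so all three change
  -- sign; yet their product is 1 at both cells.
  have h₁ := hprod j₁
  have h₂ := hprod j₂
  rw [show signOf d (unitVec a + unitVec b) 0 j₁ = -signOf d (unitVec a + unitVec b) 0 j₂ by
      linarith,
    show signOf d (unitVec a + unitVec c) 0 j₁ = -signOf d (unitVec a + unitVec c) 0 j₂ by
      linarith,
    show signOf d (unitVec b + unitVec c) 0 j₁ = -signOf d (unitVec b + unitVec c) 0 j₂ by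
      linarith] at h₁
  linarith

end SixFactors

/-! ### Five factors: at most four clear interactions -/

section FiveFactors

/-- A vector sum of five nonzero elements of `GF(2)^2` vanishes only if three of them agree, as
soon as at least five of the six pairs between these and the other two differ. -/
lemma eq_of_sum_eq_zero {a b c d e : Fin 2 → ZMod 2} (ha : a ≠ 0) (hb : b ≠ 0) (hc : c ≠ 0)
    (hd : d ≠ 0) (he : e ≠ 0) (hea : e ≠ a) (heb : e ≠ b) (hec : e ≠ c) (hdb : d ≠ b) (hdc : d ≠ c)
    (h : a + b + c + d + e = 0) : a = b ∧ b = c := by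
  have third : ∀ e d : Fin 2 → ZMod 2, ∀ b, e ≠ 0 → d ≠ 0 → b ≠ 0 → e ≠ b → d ≠ b → e ≠ d →
      b = e + d := by decide
  by_cases hde : e = d
  · subst hde
    rw [add_assoc, add_self_word, add_zero] at h
    by_cases hab : a = b
    · rw [hab, add_self_word, zero_add] at h
      exact (hc h).elim
    · rw [third b a e hb ha he (Ne.symm heb) (Ne.symm hea) (Ne.symm hab), add_comm b] at hec
      exact (hec (word_add_eq_zero_iff.1 h)).elim
  · have h1 := third e d b he hd hb heb hdb hde
    have h2 := third e d c he hd hc hec hdc hde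
    refine ⟨?_, h1.trans h2.symm⟩
    rw [add_assoc a, h2, h1, add_self_word, add_zero, add_assoc, add_comm d, ← h1] at h
    exact word_add_eq_zero_iff.1 h

/-- If five elements of `GF(2)^2` sum to zero, and enough pairs differ, three of them agree. -/
lemma exists_labelling_of_five {κ : Fin 5 → Fin 2 → ZMod 2} (h0 : ∀ l, κ l ≠ 0)
    (hsum : ∑ l, κ l = 0) (h : 5 ≤ (diffPairs κ).card) :
    ∃ a b c d e : Fin 5, [a, b, c, d, e].Nodup ∧ κ a = κ b ∧ κ a = κ c := by
  have h1 := two_mul_card_diffPairs κ h0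
  have h2 := valueCount_add κ h0
  have h3 := sum_comp_eq_valueCount κ h0 id
  simp only [id] at h3
  rw [hsum] at h3
  have h4 : (0 : ZMod 2) = valueCount κ ![0, 1] • 0 + valueCount κ ![1, 0] • 1 +
    valueCount κ ![1, 1] • 1 := congrFun h3 0
  have h5 : (0 : ZMod 2) = valueCount κ ![0, 1] • 1 + valueCount κ ![1, 0] • 0 +
    valueCount κ ![1, 1] • 1 := congrFun h3 1
  simp only [nsmul_eq_mul, mul_zero, mul_one, zero_add, add_zero] at h4 h5
  -- The coordinates of the vanishing sum make the three multiplicities congruent mod 2. Their sum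
  -- is five, so all are odd: they are 3, 1, 1 in some order.
  have hthree : ∃ v, valueCount κ v = 3 := by
    have h4' : (2 : ℕ) ∣ valueCount κ ![1, 0] + valueCount κ ![1, 1] := by
      rw [← ZMod.natCast_eq_zero_iff]
      push_cast
      exact h4.symm
    have h5' : (2 : ℕ) ∣ valueCount κ ![0, 1] + valueCount κ ![1, 1] := by
      rw [← ZMod.natCast_eq_zero_iff]
      push_cast
      exact h5.symm
    by_contra! hne
    have ha := hne ![0, 1]
    have hb := hne ![1, 0]
    have hc := hne ![1, 1]
    clear h3 h4 h5 hne
    generalize valueCount κ ![0, 1] = x at *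
    generalize valueCount κ ![1, 0] = y at *
    generalize valueCount κ ![1, 1] = z at *
    have hx : x ≤ 3 := by nlinarith
    have hy : y ≤ 3 := by nlinarith
    obtain rfl : z = 5 - x - y := by omega
    interval_cases x <;> interval_cases y <;> omega
  obtain ⟨v, hv⟩ := hthree
  obtain ⟨a, b, c, hab, hac, hbc, hs⟩ := Finset.card_eq_three.1 hv
  have hs' : (Finset.univ \ {a, b, c} : Finset (Fin 5)).card = 2 := by
    rw [← hs, Finset.card_sdiff_of_subset (subset_univ _)]
    change 5 - valueCount κ v = 2
    rw [hv]
  obtain ⟨d, e, hde, ht⟩ := Finset.card_eq_two.1 hs'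
  have hd : d ∈ (Finset.univ \ {a, b, c} : Finset (Fin 5)) := by rw [ht]; simp
  have he : e ∈ (Finset.univ \ {a, b, c} : Finset (Fin 5)) := by rw [ht]; simp
  have hmem : ∀ l ∈ ({a, b, c} : Finset (Fin 5)), κ l = v := by
    intro l hl
    rw [← hs] at hl
    exact (Finset.mem_filter.1 hl).2
  simp only [Finset.mem_sdiff, Finset.mem_univ, true_and, Finset.mem_insert,
    Finset.mem_singleton, not_or] at hd he
  have ha := hmem a (by simp)
  have hb := hmem b (by simp)
  have hc := hmem c (by simp)
  refine ⟨a, b, c, d, e, ?_, ha.trans hb.symm, ha.trans hc.symm⟩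
  simp only [List.nodup_cons, List.mem_cons, List.not_mem_nil, or_false, not_or, not_false_eq_true,
    List.nodup_nil, and_true]
  exact ⟨⟨hab, hac, Ne.symm hd.1, Ne.symm he.1⟩, ⟨hbc, Ne.symm hd.2.1, Ne.symm he.2.1⟩,
    ⟨Ne.symm hd.2.2, Ne.symm he.2.2⟩, hde⟩

lemma sum_of_nodup {M : Type*} [AddCommMonoid M] {a b c d e : Fin 5}
    (h : [a, b, c, d, e].Nodup) (g : Fin 5 → M) :
    ∑ l, g l = g a + g b + g c + g d + g e := by
  have h1 : [a, b, c, d, e].toFinset = Finset.univ :=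
    Finset.eq_univ_of_card _ (by rw [List.toFinset_card_of_nodup h]; rfl)
  rw [← h1, List.sum_toFinset _ h]
  simp [add_assoc]

/-- A graph on five vertices with an independent triple and at least five edges has a triangle, or
contains the complete bipartite graph with parts of sizes two and three up to one edge. -/
lemma graph_on_five {r : Fin 5 → Fin 5 → Prop} (hsymm : ∀ l m, r l m → r m l)
    (hirr : ∀ l, ¬ r l l) [DecidableRel r] {a b c d e : Fin 5} (h : [a, b, c, d, e].Nodup)
    (hab : ¬ r a b) (hac : ¬ r a c) (hbc : ¬ r b c)
    (hcard : 5 ≤ (Finset.univ.filter fun e : Fin 5 × Fin 5 => e.1 < e.2 ∧ r e.1 e.2).card) :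
    (∃ x y z, r x y ∧ r x z ∧ r y z) ∨
      ∃ a b c d e, [a, b, c, d, e].Nodup ∧ r e a ∧ r e b ∧ r e c ∧ r d b ∧ r d c := by
  have h1 := two_mul_card_filter_lt hsymm hirr
  rw [Finset.card_filter (fun e : Fin 5 × Fin 5 => r e.1 e.2), Fintype.sum_prod_type] at h1
  simp only [sum_of_nodup h] at h1
  have hs : ∀ l m, (r l m ↔ r m l) := fun l m => ⟨hsymm l m, hsymm m l⟩
  simp only [hirr, hs b a, hs c a, hs c b, hs a d, hs b d, hs c d, hs a e, hs b e, hs c e, hs e d,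
    hab, hac, hbc, if_false] at h1
  have h2 : 5 ≤ (if r d a then 1 else 0) + (if r e a then 1 else 0) + (if r d b then 1 else 0) +
      (if r e b then 1 else 0) + (if r d c then 1 else 0) + (if r e c then 1 else 0) +
      (if r d e then 1 else 0) := by linarith
  clear h1 hcard hs
  by_cases hde : r d e
  · left
    by_contra! hno
    -- Without a triangle on the edge `de`, each of `a`, `b`, `c` is joined to at most one of its
    -- ends, leaving at most four edges in all.
    have key : ∀ x, (if r d x then 1 else 0) + (if r e x then 1 else 0) ≤ 1 := by
      intro x
      by_cases hx : r d x
      · simp [hx, show ¬ r e x from hno d e x hde hx]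
      · simp only [hx, if_false, zero_add]
        split_ifs <;> norm_num
    have := key a
    have := key b
    have := key c
    rw [if_pos hde] at h2
    linarith
  · right
    -- At most one of the six cross pairs is missing; relabelling makes it the pair `d`, `a`.
    rw [if_neg hde] at h2
    by_cases hea : r e a
    · by_cases heb : r e b
      · by_cases hec : r e c
        · by_cases hda : r d a
          · by_cases hdb : r d b
            · exact ⟨c, a, b, d, e, by grind, hec, hea, heb, hda, hdb⟩
            · have hdc : r d c := by grind
              exact ⟨b, a, c, d, e, by grind, heb, hea, hec, hda, hdc⟩
          · have hdb : r d b := by grind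
            have hdc : r d c := by grind
            exact ⟨a, b, c, d, e, h, hea, heb, hec, hdb, hdc⟩
        · have hda : r d a := by grind
          have hdb : r d b := by grind
          have hdc : r d c := by grind
          exact ⟨c, a, b, e, d, by grind, hdc, hda, hdb, hea, heb⟩
      · have hda : r d a := by grind
        have hdb : r d b := by grind
        have hdc : r d c := by grind
        have hec : r e c := by grind
        exact ⟨b, a, c, e, d, by grind, hdb, hda, hdc, hea, hec⟩
    · have hda : r d a := by grind
      have hdb : r d b := by grind
      have hdc : r d c := by grind
      have heb : r e b := by grind
      have hec : r e c := by grind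
      exact ⟨a, b, c, e, d, by grind, hda, hdb, hdc, heb, hec⟩

theorem card_clearPairs_le_four {d : RCArray 2 2 2 5} (hu : Unreplicated d)
    (hd : ∀ l, Clear d (unitVec l)) : (clearPairs d).card ≤ 4 := by
  classical
  by_contra! hcard
  have hpairs : ∀ l : Fin 5, (Finset.univ.filter fun e : Fin 5 × Fin 5 =>
      e.1 < e.2 ∧ (e.1 = l ∨ e.2 = l)).card = 4 := by decide
  -- A clear pair avoiding `l` writes this weight-four word as that pair plus another one, so the
  -- total vanishes. Otherwise all clear pairs contain `l`, and there are at most four.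
  have hfour : ∀ l, totalSum d (1 + unitVec l) = 0 := by
    intro l
    by_contra hl
    have hsub : clearPairs d ⊆ Finset.univ.filter fun e : Fin 5 × Fin 5 =>
        e.1 < e.2 ∧ (e.1 = l ∨ e.2 = l) := by
      intro e he
      rw [mem_clearPairs] at he
      refine Finset.mem_filter.2 ⟨mem_univ _, he.1, ?_⟩
      by_contra! hne
      have hnorm : ∀ l a b : Fin 5, a ≠ b → a ≠ l → b ≠ l →
          hammingNorm (1 + unitVec l + (unitVec a + unitVec b)) = 2 := by decide
      obtain ⟨s, t, hst, hw⟩ := word_of_hammingNorm_eq_two (hnorm l e.1 e.2 he.1.ne hne.1 hne.2)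
      have hx : 1 + unitVec l = unitVec e.1 + unitVec e.2 + (unitVec s + unitVec t) := by
        rw [← hw, add_left_comm, add_self_word, add_zero]
      refine hl ?_
      rw [hx]
      refine he.2.totalSum_add_pair hst fun h => ?_
      rw [h, add_self_word] at hx
      exact absurd hx ((show ∀ l : Fin 5, (1 : Fin 5 → ZMod 2) + unitVec l ≠ 0 by decide) l)
    have := Finset.card_le_card hsub
    rw [hpairs] at this
    omega
  obtain ⟨k, hk⟩ := exists_full_word_constant (p := 2) (q := 2) hu fun x hx hx1 => by
    rcases word_cases x with h | ⟨l, rfl⟩ | h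
    · exact totalSum_eq_zero_of_hammingNorm_le hd hx (by omega)
    · exact hfour l
    · exact (hx1 h).elim
  choose κ h0 haff hclear using exists_column_slopes hd
  choose κ' h0' haff' hclear' using exists_row_slopes hd
  have hsum : ∀ j, 1 ᵥ* κ j = 0 := fun j =>
    vecMul_eq_zero_of_constant (y := d 0 j) (c := k) fun i => by rw [← haff j i]; exact hk i j
  have hsum' : ∀ i, 1 ᵥ* κ' i = 0 := fun i =>
    vecMul_eq_zero_of_constant (y := d i 0) (c := k) fun j => by rw [← haff' i j]; exact hk i j
  -- The matrix `A` stands for the slopes along any row or column. A word killed by all of them is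
  -- constant along each column and along row 0, hence on the array.
  have hconst : ∀ x, (∀ A : Matrix (Fin 5) (Fin 2) (ZMod 2), (∀ l, A l ≠ 0) → 1 ᵥ* A = 0 →
      (∀ y, Clear d y → y ᵥ* A ≠ 0) → x ᵥ* A = 0) → totalSum d x ≠ 0 := by
    intro x hx
    refine totalSum_ne_zero_of_constant (c := x ⬝ᵥ d 0 0) fun i j => ?_
    rw [haff j i, dotProduct_eq_of_vecMul_eq_zero (hx _ (h0 j) (hsum j) (hclear j)), haff' 0 j,
      dotProduct_eq_of_vecMul_eq_zero (hx _ (h0' 0) (hsum' 0) (hclear' 0))]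
  have hrows : ∀ A : Matrix (Fin 5) (Fin 2) (ZMod 2), 1 ᵥ* A = ∑ l, A l := by
    intro A
    rw [← sum_unitVec, Matrix.sum_vecMul]
    exact Finset.sum_congr rfl fun l _ => unitVec_vecMul A l
  let r : Fin 5 → Fin 5 → Prop := fun l m => l ≠ m ∧ Clear d (unitVec l + unitVec m)
  have hr : ∀ {l m}, r l m → ∀ A : Matrix (Fin 5) (Fin 2) (ZMod 2),
      (∀ y, Clear d y → y ᵥ* A ≠ 0) → A l ≠ A m := fun h A hA =>
    unitVec_add_vecMul_ne_zero_iff.1 (hA _ h.2)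
  have hdiff := hcard.trans_le (Finset.card_le_card (clearPairs_subset_diffPairs (hclear 0)))
  obtain ⟨a, b, c, e, f, hnd, hab, hac⟩ := exists_labelling_of_five (h0 0)
    ((hrows (κ 0)).symm.trans (hsum 0)) hdiff
  have hrcard : 5 ≤ (Finset.univ.filter fun e : Fin 5 × Fin 5 => e.1 < e.2 ∧ r e.1 e.2).card := by
    have : (Finset.univ.filter fun e : Fin 5 × Fin 5 => e.1 < e.2 ∧ r e.1 e.2) = clearPairs d := by
      ext e
      simp only [Finset.mem_filter, Finset.mem_univ, true_and, mem_clearPairs]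
      exact and_congr_right fun h => and_iff_right h.ne
    rw [this]
    exact hcard
  rcases graph_on_five (r := r) (fun l m h => ⟨h.1.symm, by rw [add_comm]; exact h.2⟩)
    (fun l h => h.1 rfl) hnd (fun h => hr h (κ 0) (hclear 0) hab)
    (fun h => hr h (κ 0) (hclear 0) hac)
    (fun h => hr h (κ 0) (hclear 0) (hab.symm.trans hac)) hrcard with
    ⟨x, y, z, hxy, hxz, hyz⟩ | ⟨a, b, c, e, f, hnd, hfa, hfb, hfc, heb, hec⟩
  -- A triangle carries the three distinct nonzero vectors of GF(2)^2, whose sum is zero, in every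
  -- row and column; this contradicts strength three.
  · refine hconst (unitVec x + (unitVec y + unitVec z)) (fun A hA _ hcl => ?_)
      (totalSum_triple hd hyz.1)
    rw [add_vecMul, add_vecMul, unitVec_vecMul, unitVec_vecMul, unitVec_vecMul]
    exact add_add_eq_zero_of_ne _ (hA x) _ (hA y) (hr hxy A hcl) _ (hA z) (hr hxz A hcl)
      (hr hyz A hcl)
  -- Here `eq_of_sum_eq_zero` forces `b` and `c` to have equal slopes everywhere, contradicting
  -- strength two.
  · refine hconst (unitVec b + unitVec c) (fun A hA h1 hcl => ?_)
      (totalSum_pair hd fun h => by simp [h] at hnd)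
    by_contra h2
    exact unitVec_add_vecMul_ne_zero_iff.1 h2 (eq_of_sum_eq_zero (hA a) (hA b) (hA c) (hA e) (hA f)
      (hr hfa A hcl) (hr hfb A hcl) (hr hfc A hcl) (hr heb A hcl) (hr hec A hcl)
      ((sum_of_nodup hnd fun l => A l).symm.trans ((hrows A).symm.trans h1))).2

end FiveFactors

/-! ### Arrays generated by a matrix -/

section Regular

variable {p q n : ℕ}

lemma hammingNorm_add_le (x y : Fin n → ZMod 2) :
    hammingNorm (x + y) ≤ hammingNorm x + hammingNorm y := by
  have h := hammingDist_triangle (x + y) x 0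
  rw [hammingDist_zero_right, hammingDist_zero_right, hammingDist_eq_hammingNorm] at h
  rw [show -(x + y) + x = -y by abel, neg_eq_of_add_eq_zero_left (add_self_word y)] at h
  omega

lemma hammingNorm_unitVec (l : Fin n) : hammingNorm (unitVec l) = 1 := by
  rw [hammingNorm, Finset.card_eq_one]
  exact ⟨l, by ext k; simp [Pi.single_apply]⟩

lemma hammingNorm_pair_le (l m : Fin n) : hammingNorm (unitVec l + unitVec m) ≤ 2 :=
  (hammingNorm_add_le _ _).trans (by simp [hammingNorm_unitVec])

lemma dotProduct_designOf (G : Matrix (Fin p ⊕ Fin q) (Fin n) (ZMod 2)) (x : Fin n → ZMod 2)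
    (i : Fin p → ZMod 2) (j : Fin q → ZMod 2) :
    x ⬝ᵥ designOf G i j = (G.toRows₁ *ᵥ x) ⬝ᵥ i + (G.toRows₂ *ᵥ x) ⬝ᵥ j := by
  rw [designOf, dotProduct_add, dotProduct_comm x, dotProduct_comm x, ← dotProduct_mulVec,
    ← dotProduct_mulVec, dotProduct_comm i, dotProduct_comm j]

lemma signOf_designOf (G : Matrix (Fin p ⊕ Fin q) (Fin n) (ZMod 2)) (x : Fin n → ZMod 2)
    (i : Fin p → ZMod 2) (j : Fin q → ZMod 2) :
    signOf (designOf G) x i j = sgn ((G.toRows₁ *ᵥ x) ⬝ᵥ i) * sgn ((G.toRows₂ *ᵥ x) ⬝ᵥ j) := by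
  rw [signOf, dotProduct_designOf, sgn_add]

/-- The total factors into a character sum over rows and one over columns. -/
lemma totalSum_designOf_eq_zero {G : Matrix (Fin p ⊕ Fin q) (Fin n) (ZMod 2)}
    {x : Fin n → ZMod 2} (h : G *ᵥ x ≠ 0) : totalSum (designOf G) x = 0 := by
  simp only [totalSum, signOf_designOf, ← Finset.mul_sum, ← Finset.sum_mul]
  by_cases h1 : G.toRows₁ *ᵥ x = 0
  · have h2 : G.toRows₂ *ᵥ x ≠ 0 := by
      intro h2
      refine h ?_
      rw [← fromRows_toRows G, fromRows_mulVec, h1, h2]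
      ext (i | i) <;> rfl
    rw [sum_sgn_dotProduct_of_ne h2, mul_zero]
  · rw [sum_sgn_dotProduct_of_ne h1, zero_mul]

/-- In a regular design without short defining words, the contrast of a main effect or a
two-factor interaction is clear as soon as it is not confounded with rows or columns. -/
lemma clear_designOf_iff {G : Matrix (Fin p ⊕ Fin q) (Fin n) (ZMod 2)}
    (hker : ∀ x, G *ᵥ x = 0 → x ≠ 0 → 5 ≤ hammingNorm x) {x : Fin n → ZMod 2}
    (hx : hammingNorm x ≤ 2) :
    Clear (designOf G) x ↔ G.toRows₁ *ᵥ x ≠ 0 ∧ G.toRows₂ *ᵥ x ≠ 0 := by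
  -- The word `x + y` is nonzero of weight at most four, hence outside the kernel.
  have hsum : ∀ y, hammingNorm y ≤ 2 → y ≠ x → totalSum (designOf G) (x + y) = 0 := by
    intro y hy hyx
    refine totalSum_designOf_eq_zero fun h0 => ?_
    have h1 := hker _ h0 fun h => hyx (word_add_eq_zero_iff.1 h).symm
    have h2 := hammingNorm_add_le x y
    omega
  constructor
  · rintro ⟨h1, h2, -, -⟩
    constructor
    · intro h
      have := h2 0
      simp [signOf_designOf, h] at this
    · intro h
      have := h1 0
      simp [signOf_designOf, h] at this
  · rintro ⟨h1, h2⟩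
    refine ⟨fun i => ?_, fun j => ?_, fun l hl => ?_, fun l m _ hlm => ?_⟩
    · simp only [signOf_designOf, ← Finset.mul_sum, sum_sgn_dotProduct_of_ne h2, mul_zero]
    · simp only [signOf_designOf, ← Finset.sum_mul, sum_sgn_dotProduct_of_ne h1, zero_mul]
    · exact hsum _ (by rw [hammingNorm_unitVec]; norm_num) hl
    · exact hsum _ (hammingNorm_pair_le l m) hlm

lemma mulVec_unitVec {ι : Type*} (A : Matrix ι (Fin n) (ZMod 2)) (l : Fin n) :
    A *ᵥ unitVec l = A.col l :=
  A.mulVec_single_one l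

lemma mulVec_pair_ne_zero_iff {ι : Type*} (A : Matrix ι (Fin n) (ZMod 2)) (l m : Fin n) :
    A *ᵥ (unitVec l + unitVec m) ≠ 0 ↔ A.col l ≠ A.col m := by
  rw [mulVec_add, mulVec_unitVec, mulVec_unitVec, Ne, word_add_eq_zero_iff]

lemma card_zero_set {w : Fin (n + 1) → ZMod 2} (hw : w ≠ 0) :
    (Finset.univ.filter fun x : Fin (n + 1) → ZMod 2 => w ⬝ᵥ x = 0).card = 2 ^ n := by
  have h1 := sum_sgn_dotProduct_of_ne hw
  simp only [sgn] at h1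
  rw [Finset.sum_ite, Finset.sum_const, Finset.sum_const, nsmul_eq_mul, nsmul_eq_mul] at h1
  have h2 : (Finset.univ.filter fun x : Fin (n + 1) → ZMod 2 => w ⬝ᵥ x = 0).card +
      (Finset.univ.filter fun x : Fin (n + 1) → ZMod 2 => ¬ w ⬝ᵥ x = 0).card = 2 ^ (n + 1) := by
    rw [Finset.card_filter_add_card_filter_not]
    simp
  have h3 : ((Finset.univ.filter fun x : Fin (n + 1) → ZMod 2 => w ⬝ᵥ x = 0).card : ℝ) =
      (Finset.univ.filter fun x : Fin (n + 1) → ZMod 2 => ¬ w ⬝ᵥ x = 0).card := by linarith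
  have h4 := Nat.cast_injective h3
  rw [pow_succ] at h2
  omega

lemma exists_mulVec_eq_zero (G : Matrix (Fin p ⊕ Fin q) (Fin (p + q + 1)) (ZMod 2)) :
    ∃ w, w ≠ 0 ∧ G *ᵥ w = 0 := by
  have hcard : Fintype.card (Fin p ⊕ Fin q → ZMod 2) <
      Fintype.card (Fin (p + q + 1) → ZMod 2) := by
    simp only [Fintype.card_fun, ZMod.card, Fintype.card_sum, Fintype.card_fin]
    exact Nat.pow_lt_pow_right (by norm_num) (by omega)
  obtain ⟨x, y, hxy, h⟩ := Fintype.exists_ne_map_eq_of_card_lt (fun x => G *ᵥ x) hcard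
  exact ⟨x + y, fun h0 => hxy (word_add_eq_zero_iff.1 h0), by
    rw [mulVec_add]; exact word_add_eq_zero_iff.2 h⟩

lemma unreplicated_designOf {G : Matrix (Fin p ⊕ Fin q) (Fin n) (ZMod 2)}
    (hind : ∀ v, v ᵥ* G = 0 → v = 0) : Unreplicated (designOf G) := by
  rintro ⟨i, j⟩ ⟨i', j'⟩ h
  have h1 : Sum.elim i j ᵥ* G + Sum.elim i' j' ᵥ* G = 0 := by
    rw [← fromRows_toRows G, sumElim_vecMul_fromRows, sumElim_vecMul_fromRows]
    exact word_add_eq_zero_iff.2 h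
  rw [← add_vecMul] at h1
  have h2 := word_add_eq_zero_iff.1 (hind _ h1)
  exact Prod.ext (funext fun k => congrFun h2 (Sum.inl k)) (funext fun k => congrFun h2 (Sum.inr k))

/-- One more column than rows gives a nonzero kernel word `w`. The `2 ^ (p + q)` distinct cells lie
in the hyperplane orthogonal to `w`, which has the same size. -/
lemma isFractionalFactorial_designOf {G : Matrix (Fin p ⊕ Fin q) (Fin (p + q + 1)) (ZMod 2)}
    (hind : ∀ v, v ᵥ* G = 0 → v = 0) : IsFractionalFactorial 1 (designOf G) := by
  have hu := unreplicated_designOf hind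
  obtain ⟨w, hw, hGw⟩ := exists_mulVec_eq_zero G
  refine ⟨hu, fun _ => w, linearIndependent_unique_iff.2 hw, ?_⟩
  have hmul : ∀ x, ((fun _ => w : Matrix (Fin 1) (Fin (p + q + 1)) (ZMod 2)) *ᵥ x = 0) ↔
      w ⬝ᵥ x = 0 := fun x => ⟨fun h => congrFun h 0, fun h => funext fun _ => h⟩
  have hw₁ : G.toRows₁ *ᵥ w = 0 := funext fun k => congrFun hGw (Sum.inl k)
  have hw₂ : G.toRows₂ *ᵥ w = 0 := funext fun k => congrFun hGw (Sum.inr k)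
  have himage : Finset.univ.image (fun c : (Fin p → ZMod 2) × (Fin q → ZMod 2) =>
      designOf G c.1 c.2) = Finset.univ.filter fun x => w ⬝ᵥ x = 0 := by
    refine Finset.eq_of_subset_of_card_le ?_ ?_
    · intro x hx
      obtain ⟨c, -, rfl⟩ := Finset.mem_image.1 hx
      refine Finset.mem_filter.2 ⟨mem_univ _, ?_⟩
      rw [dotProduct_designOf, hw₁, hw₂, zero_dotProduct, zero_dotProduct, add_zero]
    · rw [card_zero_set hw, Finset.card_image_of_injective _ hu]
      simp [pow_add]
  ext x
  rw [Set.mem_ofPred_eq, Set.mem_ofPred_eq, hmul]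
  have := Finset.ext_iff.1 himage x
  simpa using this

/-- A criterion for the array generated by a matrix to be 2fi-optimal. -/
theorem yieldsOptimalFraction_of {G : Matrix (Fin p ⊕ Fin q) (Fin (p + q + 1)) (ZMod 2)} {N : ℕ}
    (hind : ∀ v, v ᵥ* G = 0 → v = 0) (hker : ∀ x, G *ᵥ x = 0 → x ≠ 0 → 5 ≤ hammingNorm x)
    (h₁ : ∀ l, G.toRows₁.col l ≠ 0) (h₂ : ∀ l, G.toRows₂.col l ≠ 0)
    (hN : (Finset.univ.filter fun e : Fin (p + q + 1) × Fin (p + q + 1) => e.1 < e.2 ∧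
      G.toRows₁.col e.1 ≠ G.toRows₁.col e.2 ∧ G.toRows₂.col e.1 ≠ G.toRows₂.col e.2).card = N)
    (hmax : ∀ d : RCArray 2 p q (p + q + 1), Unreplicated d → (∀ l, Clear d (unitVec l)) →
      (clearPairs d).card ≤ N) :
    YieldsOptimalFraction 1 G ∧ numUnconfounded (designOf G) = N := by
  have hnum : numUnconfounded (designOf G) = N := by
    rw [numUnconfounded_eq_card, ← hN]
    congr 1
    ext e
    rw [mem_clearPairs, clear_designOf_iff hker (hammingNorm_pair_le _ _),
      mulVec_pair_ne_zero_iff, mulVec_pair_ne_zero_iff]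
    simp
  refine ⟨⟨?_, isFractionalFactorial_designOf hind, unreplicated_designOf hind, fun l => ?_,
    fun d hu hd => ?_⟩, hnum⟩
  · refine Fintype.linearIndependent_iff.2 fun g hg => ?_
    have : g ᵥ* G = 0 := by rw [vecMul_eq_sum]; exact hg
    exact fun i => congrFun (hind g this) i
  · rw [mainUnconfounded_iff, clear_designOf_iff hker (by rw [hammingNorm_unitVec]; norm_num),
      mulVec_unitVec, mulVec_unitVec]
    exact ⟨h₁ l, h₂ l⟩
  · rw [hnum, numUnconfounded_eq_card]
    exact hmax d hu fun l => (mainUnconfounded_iff d l).1 (hd l)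

lemma card_clearPairs_le_of_phiBound_eq {q n N : ℕ} (hq : 2 ≤ q) (hN : phiBound 2 2 q n = N)
    {d : RCArray 2 2 q n} (hd : ∀ l, Clear d (unitVec l)) : (clearPairs d).card ≤ N := by
  have h := card_clearPairs_le_phiBound hq hd
  rw [hN] at h
  exact_mod_cast h

end Regular

/-! ### The cases `q = 2, 3, 4` -/

section SmallCases

lemma genA_optimal : YieldsOptimalFraction 1 genA ∧ numUnconfounded (designOf genA) = 4 :=
  yieldsOptimalFraction_of (by decide +kernel) (by decide +kernel) (by decide +kernel)
    (by decide +kernel) (by decide +kernel) fun _ hu hd => card_clearPairs_le_four hu hd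

lemma genB_optimal : YieldsOptimalFraction 1 genB ∧ numUnconfounded (designOf genB) = 11 :=
  yieldsOptimalFraction_of (by decide +kernel) (by decide +kernel) (by decide +kernel)
    (by decide +kernel) (by decide +kernel) fun _ hu hd => card_clearPairs_le_eleven hu hd

lemma genC_optimal : YieldsOptimalFraction 1 genC ∧ numUnconfounded (designOf genC) = 16 :=
  yieldsOptimalFraction_of (by decide +kernel) (by decide +kernel) (by decide +kernel)
    (by decide +kernel) (by decide +kernel) fun _ _ hd =>
      card_clearPairs_le_of_phiBound_eq (by norm_num)
        (by rw [phiBound_eq _ _ (by norm_num)]; norm_num) hd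

end SmallCases

/-! ### The case `q ≥ 5` -/

section GeneralCase

variable {q : ℕ}

/-- The generator matrix `genD` with its blocks of rows and columns kept apart. -/
def blockD (q : ℕ) (X : Matrix (Fin 2) (Fin (q - 3)) (ZMod 2)) :
    Matrix (Fin 2 ⊕ (Fin 3 ⊕ Fin (q - 3))) (((Fin 2 ⊕ Fin 3) ⊕ Fin 1) ⊕ Fin (q - 3)) (ZMod 2) :=
  Matrix.fromRows
    (Matrix.fromCols (Matrix.fromCols (Matrix.fromCols 1 matF) (oneCol 2)) X)
    (Matrix.fromRows
      (Matrix.fromCols (Matrix.fromCols (Matrix.fromCols matE (1 + matE * matF)) (oneCol 3)) 0)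
      (Matrix.fromCols
        (Matrix.fromCols (0 : Matrix (Fin (q - 3)) (Fin 2 ⊕ Fin 3) (ZMod 2)) (oneCol (q - 3)))
        1))

lemma genD_eq (hq : 5 ≤ q) (X : Matrix (Fin 2) (Fin (q - 3)) (ZMod 2)) :
    genD q hq X = (blockD q X).submatrix
      (Equiv.sumCongr (Equiv.refl (Fin 2)) (rowBlocks q (by omega)).symm)
      (colBlocks q (by omega)).symm := rfl

lemma matEF : (1 + matE * matF : Matrix (Fin 3) (Fin 3) (ZMod 2)) =
    !![0, 0, 1; 1, 0, 0; 0, 1, 0] := by decide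

lemma blockD_lower_rows {X : Matrix (Fin 2) (Fin (q - 3)) (ZMod 2)}
    {y : ((Fin 2 ⊕ Fin 3) ⊕ Fin 1) ⊕ Fin (q - 3) → ZMod 2}
    (h : ∀ k, (blockD q X *ᵥ y) (.inr k) = 0) :
    (∀ k, y (.inr k) = y (.inl (.inr 0))) ∧
      y (.inl (.inl (.inl 0))) + y (.inl (.inl (.inr 2))) + y (.inl (.inr 0)) = 0 ∧
      y (.inl (.inl (.inl 1))) + y (.inl (.inl (.inr 0))) + y (.inl (.inr 0)) = 0 ∧
      y (.inl (.inl (.inl 0))) + y (.inl (.inl (.inl 1))) + y (.inl (.inl (.inr 1))) +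
        y (.inl (.inr 0)) = 0 := by
  refine ⟨fun k => ?_, ?_, ?_, ?_⟩
  · have := h (.inr k)
    simp [blockD, mulVec, dotProduct, oneCol, Matrix.one_apply] at this
    rw [add_comm] at this
    calc y (.inr k) = y (.inr k) + y (.inl (.inr 0)) + y (.inl (.inr 0)) := by
          rw [add_assoc, add_self_zmod_two, add_zero]
      _ = y (.inl (.inr 0)) := by rw [this, zero_add]
  · have := h (.inl 0)
    simp only [blockD, matEF] at this
    simpa [mulVec, dotProduct, oneCol, Fin.sum_univ_two, Fin.sum_univ_three, matE] using this
  · have := h (.inl 1)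
    simp only [blockD, matEF] at this
    simpa [mulVec, dotProduct, oneCol, Fin.sum_univ_two, Fin.sum_univ_three, matE] using this
  · have := h (.inl 2)
    simp only [blockD, matEF] at this
    simpa [mulVec, dotProduct, oneCol, Fin.sum_univ_two, Fin.sum_univ_three, matE] using this

lemma blockD_upper_rows {X : Matrix (Fin 2) (Fin (q - 3)) (ZMod 2)}
    {y : ((Fin 2 ⊕ Fin 3) ⊕ Fin 1) ⊕ Fin (q - 3) → ZMod 2}
    (h : ∀ k, (blockD q X *ᵥ y) (.inl k) = 0) (ht : y (.inl (.inr 0)) = 0)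
    (hlow : ∀ k, y (.inr k) = 0) :
    y (.inl (.inl (.inl 0))) + (y (.inl (.inl (.inr 0))) + y (.inl (.inl (.inr 2)))) = 0 ∧
      y (.inl (.inl (.inl 1))) + (y (.inl (.inl (.inr 0))) + y (.inl (.inl (.inr 1)))) = 0 := by
  have h0 := h 0
  have h1 := h 1
  simp [blockD, mulVec, dotProduct, oneCol, Fin.sum_univ_two, Fin.sum_univ_three, matF, ht,
    hlow] at h0 h1
  exact ⟨h0, h1⟩

lemma blockD_vecMul_eq_zero {X : Matrix (Fin 2) (Fin (q - 3)) (ZMod 2)}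
    {v : Fin 2 ⊕ (Fin 3 ⊕ Fin (q - 3)) → ZMod 2} (h : v ᵥ* blockD q X = 0) : v = 0 := by
  have h0 := congrFun h (.inl (.inl (.inl 0)))
  have h1 := congrFun h (.inl (.inl (.inl 1)))
  have h2 := congrFun h (.inl (.inl (.inr 0)))
  have h3 := congrFun h (.inl (.inl (.inr 1)))
  have h4 := congrFun h (.inl (.inl (.inr 2)))
  have h5 := fun k => congrFun h (.inr k)
  simp only [blockD, matEF] at h0 h1 h2 h3 h4
  simp [vecMul, dotProduct, Fin.sum_univ_two, Fin.sum_univ_three, matE, matF] at h0 h1 h2 h3 h4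
  simp [blockD, vecMul, dotProduct, Matrix.one_apply] at h5
  have key : v (.inl 0) = 0 ∧ v (.inl 1) = 0 ∧ v (.inr (.inl 0)) = 0 ∧ v (.inr (.inl 1)) = 0 ∧
      v (.inr (.inl 2)) = 0 := by
    clear h5 h
    generalize v (.inl 0) = a at *
    generalize v (.inl 1) = b at *
    generalize v (.inr (.inl 0)) = c at *
    generalize v (.inr (.inl 1)) = d at *
    generalize v (.inr (.inl 2)) = e at *
    revert a b c d e
    decide
  obtain ⟨k0, k1, k2, k3, k4⟩ := key
  ext (r | r | r)
  · fin_cases r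
    exacts [k0, k1]
  · fin_cases r
    exacts [k2, k3, k4]
  · simpa [k0, k1] using h5 r

lemma hammingNorm_comp_equiv {ι κ : Type*} [Fintype ι] [Fintype κ] (e : ι ≃ κ)
    (x : κ → ZMod 2) : hammingNorm (x ∘ e) = hammingNorm x := by
  simp only [hammingNorm, Finset.card_filter, Function.comp]
  exact Equiv.sum_comp e fun k => if x k ≠ 0 then 1 else 0

/-- The contribution of a symbol to the weight of a word. -/
def symbolWeight (u : ZMod 2) : ℕ := if u ≠ 0 then 1 else 0

lemma hammingNorm_blocks (y : ((Fin 2 ⊕ Fin 3) ⊕ Fin 1) ⊕ Fin (q - 3) → ZMod 2)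
    (h : ∀ k, y (.inr k) = y (.inl (.inr 0))) :
    hammingNorm y = symbolWeight (y (.inl (.inl (.inl 0)))) +
      symbolWeight (y (.inl (.inl (.inl 1)))) + (symbolWeight (y (.inl (.inl (.inr 0)))) +
        symbolWeight (y (.inl (.inl (.inr 1)))) + symbolWeight (y (.inl (.inl (.inr 2))))) +
      symbolWeight (y (.inl (.inr 0))) + (q - 3) * symbolWeight (y (.inl (.inr 0))) := by
  simp only [hammingNorm, Finset.card_filter, Fintype.sum_sum_type, h, symbolWeight,
    Fin.sum_univ_two, Fin.sum_univ_three, Fin.sum_univ_one, Finset.sum_const, Finset.card_univ,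
    Fintype.card_fin, smul_eq_mul]

/-- The letters are the entries of a lower kernel word at the columns of `I_2` (`a`, `b`), of `F`
(`c`, `d`, `e`) and at the all-one column (`t`). For `t = 0` the upper rows cannot vanish as well,
because `(I F; E I + EF)` is a product of unitriangular block matrices. -/
lemma symbolWeight_lower : ∀ a b c d e t : ZMod 2, a + e + t = 0 → b + c + t = 0 →
    a + b + d + t = 0 →
    (t = 0 ∧ (a = 0 ∧ b = 0 ∧ c = 0 ∧ d = 0 ∧ e = 0 ∨
      3 ≤ symbolWeight a + symbolWeight b + (symbolWeight c + symbolWeight d + symbolWeight e) ∧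
        ¬ (a + (c + e) = 0 ∧ b + (c + d) = 0))) ∨
    (t = 1 ∧
      2 ≤ symbolWeight a + symbolWeight b + (symbolWeight c + symbolWeight d + symbolWeight e)) := by
  decide

/-- The last `q - 3` rows make the final block of the word constant, equal to `t`, which reduces
everything to `symbolWeight_lower`. Either alternative gives weight at least three, so the lower
columns are nonzero and distinct; together they bound the weight of full kernel words by five from
below. -/
lemma genD_lower_kernel (hq : 5 ≤ q) (X : Matrix (Fin 2) (Fin (q - 3)) (ZMod 2))
    {x : Fin (2 + q + 1) → ZMod 2} (h : (genD q hq X).toRows₂ *ᵥ x = 0) (hx : x ≠ 0) :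
    5 ≤ hammingNorm x ∨ 3 ≤ hammingNorm x ∧ (genD q hq X).toRows₁ *ᵥ x ≠ 0 := by
  set f := colBlocks q (by omega) with hf
  have hmul : genD q hq X *ᵥ x = (blockD q X *ᵥ (x ∘ f)) ∘
      (Equiv.sumCongr (Equiv.refl (Fin 2)) (rowBlocks q (by omega)).symm) := by
    rw [genD_eq, submatrix_mulVec_equiv, Equiv.symm_symm]
  have hlow : ∀ k, (blockD q X *ᵥ (x ∘ f)) (.inr k) = 0 := by
    intro k
    have h1 : (genD q hq X *ᵥ x) (.inr (rowBlocks q (by omega) k)) = 0 :=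
      congrFun h (rowBlocks q (by omega) k)
    rw [hmul] at h1
    simpa using h1
  have hup : (genD q hq X).toRows₁ *ᵥ x = 0 → ∀ k, (blockD q X *ᵥ (x ∘ f)) (.inl k) = 0 := by
    intro h0 k
    have h1 : (genD q hq X *ᵥ x) (.inl k) = 0 := congrFun h0 k
    rw [hmul] at h1
    simpa using h1
  rw [← hammingNorm_comp_equiv f x]
  have hy0 : x ∘ f ≠ 0 := by
    intro h0
    refine hx (funext fun l => ?_)
    simpa using congrFun h0 (f.symm l)
  generalize x ∘ f = y at *
  obtain ⟨hk, h1, h2, h3⟩ := blockD_lower_rows hlow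
  rw [hammingNorm_blocks y hk]
  rcases symbolWeight_lower _ _ _ _ _ _ h1 h2 h3 with
    ⟨ht, ⟨k0, k1, k2, k3, k4⟩ | ⟨hw, hne⟩⟩ | ⟨ht, hw⟩
  · refine (hy0 ?_).elim
    ext (((r | r) | r) | r)
    · fin_cases r
      exacts [k0, k1]
    · fin_cases r
      exacts [k2, k3, k4]
    · fin_cases r
      exact ht
    · exact (hk r).trans ht
  · refine .inr ⟨by omega, fun h0 => hne ?_⟩
    exact blockD_upper_rows (hup h0) ht fun k => (hk k).trans ht
  · left
    -- The weight is at least `2 + 1 + (q - 3) = q`; this is where `q ≥ 5` matters.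
    rw [ht, show symbolWeight 1 = 1 from rfl]
    omega

lemma genD_vecMul_eq_zero (hq : 5 ≤ q) (X : Matrix (Fin 2) (Fin (q - 3)) (ZMod 2))
    {v : Fin 2 ⊕ Fin q → ZMod 2} (h : v ᵥ* genD q hq X = 0) : v = 0 := by
  rw [genD_eq, submatrix_vecMul_equiv] at h
  have h1 := blockD_vecMul_eq_zero (X := X) (v := v ∘ _) (funext fun l => by
    simpa using congrFun h (colBlocks q (by omega) l))
  ext r
  simpa using congrFun h1 (Equiv.sumCongr (Equiv.refl (Fin 2)) (rowBlocks q (by omega)).symm r)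

lemma genD_upper_col (hq : 5 ≤ q) (X : Matrix (Fin 2) (Fin (q - 3)) (ZMod 2))
    (b : ((Fin 2 ⊕ Fin 3) ⊕ Fin 1) ⊕ Fin (q - 3)) :
    (genD q hq X).toRows₁.col (colBlocks q (by omega) b) = fun r => blockD q X (.inl r) b := by
  ext r
  simp [genD_eq]

lemma genD_upper_col_ne_zero (hq : 5 ≤ q) {X : Matrix (Fin 2) (Fin (q - 3)) (ZMod 2)}
    (hX : ∀ j, X.col j ≠ 0) (l : Fin (2 + q + 1)) : (genD q hq X).toRows₁.col l ≠ 0 := by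
  obtain ⟨b, rfl⟩ := (colBlocks q (by omega)).surjective l
  rw [genD_upper_col]
  rcases b with ((r | r) | r) | r
  · exact (show ∀ r : Fin 2, (fun k => (1 : Matrix (Fin 2) (Fin 2) (ZMod 2)) k r) ≠ 0 by decide) r
  · exact (show ∀ r : Fin 3, (fun k => matF k r) ≠ 0 by decide) r
  · exact (show ∀ r : Fin 1, (fun k => oneCol 2 k r) ≠ 0 by decide) r
  · exact hX r

/-- The six columns of `(I | F | 1)` contain each nonzero vector exactly twice. -/
lemma valueCount_genD (hq : 5 ≤ q) (X : Matrix (Fin 2) (Fin (q - 3)) (ZMod 2))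
    {v : Fin 2 → ZMod 2} (hv : v ≠ 0) :
    valueCount (genD q hq X).toRows₁.col v =
      2 + (Finset.univ.filter fun j => X.col j = v).card := by
  have h1 : valueCount (genD q hq X).toRows₁.col v =
      ∑ b, if (fun r => blockD q X (.inl r) b) = v then 1 else 0 := by
    rw [valueCount, Finset.card_filter, ← Equiv.sum_comp (colBlocks q (by omega))]
    simp only [genD_upper_col]
  rw [h1, Fintype.sum_sum_type, Finset.card_filter]
  congr 1
  have hM : ∀ b, (fun r => blockD q X (.inl r) (.inl b)) =
      fun r => (Matrix.fromCols (Matrix.fromCols 1 matF) (oneCol 2) :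
        Matrix (Fin 2) ((Fin 2 ⊕ Fin 3) ⊕ Fin 1) (ZMod 2)) r b := fun b => rfl
  simp only [hM]
  clear h1
  revert v
  decide

lemma span_singleton_eq_iff {V : Type*} [AddCommGroup V] [Module (ZMod 2) V] {c v : V}
    (hv : v ≠ 0) : Submodule.span (ZMod 2) {c} = Submodule.span (ZMod 2) {v} ↔ c = v := by
  refine ⟨fun h => ?_, fun h => by rw [h]⟩
  have h1 : v ∈ Submodule.span (ZMod 2) {c} := by
    rw [h]; exact Submodule.mem_span_singleton_self v
  obtain ⟨u, hu⟩ := Submodule.mem_span_singleton.1 h1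
  rcases zmod_two_cases u with rfl | rfl
  · rw [zero_smul] at hu
    exact (hv hu.symm).elim
  · rwa [one_smul] at hu

lemma pointCount_mk {m n : ℕ} (A : Matrix (Fin m) (Fin n) (ZMod 2)) {v : Fin m → ZMod 2}
    (hv : v ≠ 0) : pointCount A (Projectivization.mk (ZMod 2) v hv) = valueCount A.col v := by
  rw [pointCount, valueCount, ← Set.ncard_coe_finset]
  congr 1
  ext j
  simp [Projectivization.submodule_mk, span_singleton_eq_iff hv]

theorem genD_optimal (hq : 5 ≤ q) {X : Matrix (Fin 2) (Fin (q - 3)) (ZMod 2)}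
    (hX : BalancedBlock q hq X) : YieldsOptimalFraction 1 (genD q hq X) ∧
      (numUnconfounded (designOf (genD q hq X)) : ℚ) = phiBound 2 2 q (2 + q + 1) := by
  have h₁ := genD_upper_col_ne_zero hq hX.1
  have hcard := card_diffPairs_of_balanced (genD q hq X).toRows₁.col h₁ (q := q) (by omega)
    fun v hv => by
      rw [← pointCount_mk _ hv]
      exact hX.2 _
  have hpair : ∀ {l m}, l ≠ m → (genD q hq X).toRows₂.col l ≠ (genD q hq X).toRows₂.col m := by
    intro l m hlm
    rw [← mulVec_pair_ne_zero_iff]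
    intro h
    have h1 := hammingNorm_pair_le l m
    have h2 := genD_lower_kernel hq X h fun h0 =>
      hlm (unitVec_injective (word_add_eq_zero_iff.1 h0))
    omega
  have key := yieldsOptimalFraction_of (G := genD q hq X)
    (N := (diffPairs (genD q hq X).toRows₁.col).card)
    (fun v => genD_vecMul_eq_zero hq X) (fun x hx h0 => ?_) h₁ (fun l => ?_) ?_
    (fun d _ hd => card_clearPairs_le_of_phiBound_eq (by omega) hcard.symm hd)
  · exact ⟨key.1, by rw [key.2, hcard]⟩
  · have ha : (genD q hq X).toRows₁ *ᵥ x = 0 := funext fun k => congrFun hx (Sum.inl k)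
    have hb : (genD q hq X).toRows₂ *ᵥ x = 0 := funext fun k => congrFun hx (Sum.inr k)
    exact (genD_lower_kernel hq X hb h0).resolve_right fun h => h.2 ha
  · rw [← mulVec_unitVec]
    intro h
    have h1 := hammingNorm_unitVec l
    have h2 := genD_lower_kernel hq X h fun h0 => by simpa using congrFun h0 l
    omega
  · congr 1
    ext e
    simp only [diffPairs, Finset.mem_filter, Finset.mem_univ, true_and]
    exact and_congr_right fun h => and_iff_left (hpair h.ne)

/-- With `n = 3α + β` the bound equals `3α² + 2αβ + β(β - 1)/2`. -/
lemma phiBound_pos {n : ℕ} (hq : 2 ≤ q) (hn : 3 ≤ n) : 0 < phiBound 2 2 q n := by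
  have h1 : (n : ℚ) = 3 * (n / 3 : ℕ) + (n % 3 : ℕ) := by exact_mod_cast (Nat.div_add_mod n 3).symm
  have h2 : (1 : ℚ) ≤ (n / 3 : ℕ) := by exact_mod_cast (by omega : 1 ≤ n / 3)
  have h3 : ((n % 3 : ℕ) : ℚ) ≤ (n % 3 : ℕ) * (n % 3 : ℕ) := by exact_mod_cast Nat.le_mul_self _
  have h4 : (0 : ℚ) ≤ (n % 3 : ℕ) := Nat.cast_nonneg _
  rw [phiBound_eq q n hq]
  generalize ((n / 3 : ℕ) : ℚ) = α at *
  generalize ((n % 3 : ℕ) : ℚ) = β at *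
  rw [h1]
  nlinarith

lemma card_filter_mod_three (m r : ℕ) (hr : r < 3) :
    (∑ k ∈ Finset.range m, if k % 3 = r then 1 else 0) = (m + 2 - r) / 3 := by
  induction m with
  | zero => simp; omega
  | succ m ih =>
    rw [Finset.sum_range_succ, ih]
    split_ifs <;> omega

lemma exists_balancedBlock (hq : 5 ≤ q) :
    ∃ X : Matrix (Fin 2) (Fin (q - 3)) (ZMod 2), BalancedBlock q hq X := by
  -- Cycling through the three points keeps their multiplicities within one of each other, and the
  -- fixed columns add two to each.
  let pt : ℕ → Fin 2 → ZMod 2 := fun k => if k % 3 = 0 then ![0, 1] else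
    if k % 3 = 1 then ![1, 0] else ![1, 1]
  have hpt : ∀ v : Fin 2 → ZMod 2, v ≠ 0 → ∃ r < 3, ∀ k, (pt k = v ↔ k % 3 = r) := by
    intro v hv
    rcases fin_two_arrow_cases v with rfl | rfl | rfl | rfl
    · exact (hv (by decide)).elim
    · refine ⟨0, by norm_num, fun k => ?_⟩
      simp only [pt]
      split_ifs <;> simp <;> omega
    · refine ⟨1, by norm_num, fun k => ?_⟩
      simp only [pt]
      split_ifs <;> simp <;> omega
    · refine ⟨2, by norm_num, fun k => ?_⟩
      simp only [pt]
      split_ifs <;> simp <;> omega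
  have hpt0 : ∀ k, pt k ≠ 0 := by
    intro k
    simp only [pt]
    split_ifs <;> decide
  refine ⟨Matrix.of fun r j => pt j r, fun j => hpt0 j, fun P => ?_⟩
  induction P using Projectivization.ind with
  | h v hv =>
    obtain ⟨r, hr, hpr⟩ := hpt v hv
    rw [pointCount_mk _ hv, valueCount_genD hq _ hv, Finset.card_filter]
    have : ∀ j : Fin (q - 3), (Matrix.of fun r (j : Fin (q - 3)) => pt j r).col j = v ↔
        (j : ℕ) % 3 = r := fun j => hpr j
    simp only [this]
    rw [Fin.sum_univ_eq_sum_range (fun k => if k % 3 = r then 1 else 0), card_filter_mod_three _ _ hr]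
    omega

end GeneralCase

theorem theorem6 :
    (YieldsOptimalFraction 1 genA ∧ twoFiEfficiency (designOf genA) = 1 / 2) ∧
    (YieldsOptimalFraction 1 genB ∧ twoFiEfficiency (designOf genB) = 11 / 12) ∧
    (YieldsOptimalFraction 1 genC ∧ twoFiEfficiency (designOf genC) = 1) ∧
    (∀ (q : ℕ) (hq : 5 ≤ q),
      (∃ X : Matrix (Fin 2) (Fin (q - 3)) (ZMod 2), BalancedBlock q hq X) ∧
      ∀ X : Matrix (Fin 2) (Fin (q - 3)) (ZMod 2), BalancedBlock q hq X →
        YieldsOptimalFraction 1 (genD q hq X) ∧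
          twoFiEfficiency (designOf (genD q hq X)) = 1) := by
  refine ⟨⟨genA_optimal.1, ?_⟩, ⟨genB_optimal.1, ?_⟩, ⟨genC_optimal.1, ?_⟩, fun q hq =>
    ⟨exists_balancedBlock hq, fun X hX => ⟨(genD_optimal hq hX).1, ?_⟩⟩⟩
  · rw [twoFiEfficiency, genA_optimal.2, phiBound_eq _ _ (by norm_num)]
    norm_num
  · rw [twoFiEfficiency, genB_optimal.2, phiBound_eq _ _ (by norm_num)]
    norm_num
  · rw [twoFiEfficiency, genC_optimal.2, phiBound_eq _ _ (by norm_num)]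
    norm_num
  · have h := (genD_optimal hq hX).2
    rw [twoFiEfficiency, h]
    exact div_self (phiBound_pos (by omega) (by omega)).ne'
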